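/- **Proposition 3.4.** *Setting.* A context-free grammar (CFG) is $G=(N,T,P,S)$ with $T=\{0,1\}$, a finite set $N$ of nonterminals, a start symbol $S\in N$ and a finite set $P$ of rules $A\to\alpha$ with $A\in N$, $\alpha\in(N\cup T)^*$; it is linear if every right-hand side $\alpha$ contains at most one occurrence of a nonterminal. Let $\langle G\rangle\in\{0,1\}^*$ be the standard binary code of $G$ (the number of nonterminals, the start symbol, and the rules, each rule being listed exactly once as a sequence of binary symbol numbers with separators). Let $\mathcal R_{\mathsf{CFG}}(\langle G\rangle):\{0,1\}^*\to\{0,1\}$ be the indicator function of the language of $G$, and let $\mathcal R_{\mathsf{CFG}}(p)\equiv 0$ if $p$ is not a code of a CFG. Let $\mathcal R_{\mathsf{L\text{-}CFG}}(p)=\mathcal R_{\mathsf{CFG}}(p)$ if $p$ is the code of a linear CFG and $\mathcal R_{\mathsf{L\text{-}CFG}}(p)\equiv0$ otherwise. Let $\mathcal F_{\mathsf{CFG}}$ and $\mathcal F_{\mathsf{L\text{-}CFG}}$ be the sets of all functions $\mathcal R_{\mathsf{CFG}}(p)$, respectively $\mathcal R_{\mathsf{L\text{-}CFG}}(p)$,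 with $p\in\{0,1\}^*$. Let $\mathcal C:\{0,1\}^*\to\mathbb N$ be any function with $\mathcal C(\langle G\rangle)=|N|+|T|+|P|$ for every CFG $G$, where $|P|=\sum_{(A\to\alpha)\in P}(1+|\alpha|)$ is the total length of the rules. For $f:\{0,1\}^*\to\{0,1\}$ let $D_n(f)=\{(x,f(x)):|x|\le n\}$. A learning algorithm is a computable function $\mathcal A$ from finite sets of labelled strings to $\{0,1\}^*$. For $\mathcal R\in\{\mathcal R_{\mathsf{CFG}},\mathcal R_{\mathsf{L\text{-}CFG}}\}$ put $\mathcal C^{\mathcal R}(f)=\min\{\mathcal C(p):\mathcal R(p)=f\}$, $$N^{\mathcal R}_{\mathcal A}(f)=\min\{n_0\ge 0:\forall n\ge n_0,\ \mathcal R(\mathcal A(D_n(f)))=f\}\in\mathbb N\cup\{\infty\},$$ $$N^{\mathcal R,\mathcal F}_{\mathcal A}(c)=\sup\{N^{\mathcal R}_{\mathcal A}(f):f\in\mathcal F,\ \mathcal C^{\mathcal R}(f)\le c\},$$ with $\min\emptyset=\infty$ and $\sup\emptyset=0$. A function $u:\mathbb N\to\mathbb N\cup\{\infty\}$ is computably bounded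 if $u\le g$ for some computable $g:\mathbb N\to\mathbb N$. The class $\mathcal F$ admits length generalization in the limit w.r.t. $\mathcal R$ if some learning algorithm $\mathcal A$ has $N^{\mathcal R}_{\mathcal A}(f)<\infty$ for all $f\in\mathcal F$. It admits non-asymptotic length generalization w.r.t. $\mathcal R$ and $\mathcal C$ if there are a learning algorithm $\mathcal A$ and a computable $g:\mathbb N\to\mathbb N$ such that $\mathcal R(\mathcal A(D_n(f)))=f$ for all $f\in\mathcal F$ and all $n\ge g(\mathcal C^{\mathcal R}(f))$. *Claim.* 1. $\mathcal R_{\mathsf{L\text{-}CFG}}$ and $\mathcal R_{\mathsf{CFG}}$ are encoding systems: an algorithm turns every $p$ into a program of the total function $\mathcal R(p)$. 2. For every learning algorithm $\mathcal A$, the length complexity $c\mapsto N^{\mathcal R,\mathcal F}_{\mathcal A}(c)$ with $\mathcal R=\mathcal R_{\mathsf{L\text{-}CFG}}$ and $\mathcal F=\mathcal F_{\mathsf{L\text{-}CFG}}$ is not computably bounded. 3. $\mathcal F_{\mathsf{L\text{-}CFG}}$ does not admit non-asymptotic length generalization w.r.t. $\mathcal C$ and $\mathcal R_{\mathsf{L\text{-}CFG}}$,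 nor w.r.t. $\mathcal C$ and $\mathcal R_{\mathsf{CFG}}$; and $\mathcal F_{\mathsf{CFG}}$ does not admit it w.r.t. $\mathcal C$ and $\mathcal R_{\mathsf{CFG}}$. 4. $\mathcal F_{\mathsf{L\text{-}CFG}}$ admits length generalization in the limit w.r.t. $\mathcal R_{\mathsf{L\text{-}CFG}}$ and w.r.t. $\mathcal R_{\mathsf{CFG}}$, and $\mathcal F_{\mathsf{CFG}}$ admits it w.r.t. $\mathcal R_{\mathsf{CFG}}$. -/

import Mathlib

/-! ### Learning from all labelled data up to a given length -/

namespace LengthGen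

/-- The binary strings of length exactly `n`, in lexicographic order. -/
def stringsOfLength : ℕ → List (List Bool)
  | 0 => [[]]
  | n + 1 => (stringsOfLength n).map (List.cons false) ++ (stringsOfLength n).map (List.cons true)

/-- The binary strings of length at most `N`, in length-lexicographic order. -/
def stringsUpTo (N : ℕ) : List (List Bool) :=
  (List.range (N + 1)).flatMap stringsOfLength

theorem mem_stringsOfLength {n : ℕ} {x : List Bool} : x ∈ stringsOfLength n ↔ x.length = n := by
  induction n generalizing x with
  | zero => simp [stringsOfLength]
  | succ n ih =>
    rcases x with _ | ⟨b, x⟩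
    · simp [stringsOfLength]
    · cases b <;> simp [stringsOfLength, ih]

theorem mem_stringsUpTo {N : ℕ} {x : List Bool} : x ∈ stringsUpTo N ↔ x.length ≤ N := by
  simp [stringsUpTo, mem_stringsOfLength]

/-- The training set `D_N(f) = {(x, f x) : |x| ≤ N}`, written as a list (every pair occurs once,
in length-lexicographic order of `x`) so that it can be the input of an algorithm. -/
def trainingSet (N : ℕ) (f : List Bool → Bool) : List (List Bool × Bool) :=
  (stringsUpTo N).map fun x => (x, f x)

/-- `R` is (the semantics of) an encoding system: there is an algorithm which turns every string
`p` into a program of the total function `R p : {0,1}* → {0,1}`. -/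
def IsEncodingSystem (R : List Bool → List Bool → Bool) : Prop :=
  ∃ e : List Bool → Nat.Partrec.Code, Computable e ∧
    ∀ p x, (e p).eval (Encodable.encode x) = Part.some (Encodable.encode (R p x))

/-- The complexity of a function: the least complexity of a string that represents it.
(Only meaningful for `f ∈ Set.range R`.) -/
noncomputable def funComplexity (R : List Bool → List Bool → Bool) (C : List Bool → ℕ)
    (f : List Bool → Bool) : ℕ :=
  sInf {k | ∃ p, R p = f ∧ C p = k}

/-- The learner `A` length-generalizably learns `f` at input length `N`. -/
def LearnsAt (R : List Bool → List Bool → Bool) (A : List (List Bool × Bool) → List Bool)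
    (f : List Bool → Bool) (N : ℕ) : Prop :=
  R (A (trainingSet N f)) = f

/-- `F` admits length generalization in the limit with respect to `R`. Learning algorithms are
computable functions from training sets to strings. -/
def AdmitsLimit (R : List Bool → List Bool → Bool) (F : Set (List Bool → Bool)) : Prop :=
  ∃ A : List (List Bool × Bool) → List Bool, Computable A ∧
    ∀ f ∈ F, ∃ N, ∀ N' ≥ N, LearnsAt R A f N'

/-- `F` admits non-asymptotic length generalization with respect to `R` and `C`. -/
def AdmitsNonAsymptotic (R : List Bool → List Bool → Bool) (C : List Bool → ℕ)
    (F : Set (List Bool → Bool)) : Prop :=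
  ∃ A : List (List Bool × Bool) → List Bool, Computable A ∧
    ∃ g : ℕ → ℕ, Computable g ∧
      ∀ f ∈ F, ∀ N' ≥ g (funComplexity R C f), LearnsAt R A f N'

/-- The length complexity of `f` for the learner `A`, which is `∞` if no length suffices. -/
noncomputable def lengthComplexity (R : List Bool → List Bool → Bool)
    (A : List (List Bool × Bool) → List Bool) (f : List Bool → Bool) : ℕ∞ :=
  sInf ((fun N : ℕ => (N : ℕ∞)) '' {N | ∀ n ≥ N, LearnsAt R A f n})

/-- The length complexity for the learner `A` of the functions in `F` of complexity at most `c`. -/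
noncomputable def lengthComplexityUpTo (R : List Bool → List Bool → Bool) (C : List Bool → ℕ)
    (F : Set (List Bool → Bool)) (A : List (List Bool × Bool) → List Bool) (c : ℕ) : ℕ∞ :=
  sSup (lengthComplexity R A '' {f | f ∈ F ∧ funComplexity R C f ≤ c})

/-- `u` is bounded by a (total) computable function. -/
def ComputablyBounded (u : ℕ → ℕ∞) : Prop :=
  ∃ g : ℕ → ℕ, Computable g ∧ ∀ n, u n ≤ (g n : ℕ∞)

/-! ### Context-free grammars over `{0,1}` and their binary codes -/

/-- A context-free grammar over the terminals `{0,1}`. The nonterminals are numbered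
`0, …, numNT - 1` and the finite set of rules is listed in some order, without repetition. -/
structure CFG where
  numNT : ℕ
  start : Fin numNT
  rules : List (ContextFreeRule Bool (Fin numNT))
  nodup : rules.Nodup

namespace CFG

/-- The underlying grammar. -/
def toGrammar (G : CFG) : ContextFreeGrammar Bool where
  NT := Fin G.numNT
  initial := G.start
  rules := G.rules.toFinset

/-- `|N| + |T| + |P|` with `|T| = 2` and `|P|` the total length of the rules, where the length of
`A → α` is `1 + |α|`. -/
def size (G : CFG) : ℕ :=
  G.numNT + 2 + (G.rules.map fun r => 1 + r.output.length).sum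

/-- Whether a symbol is a nonterminal. -/
def isNonterminal {T N : Type} : Symbol T N → Bool
  | .terminal _ => false
  | .nonterminal _ => true

/-- Every right-hand side contains at most one occurrence of a nonterminal. -/
def IsLinear (G : CFG) : Prop :=
  ∀ r ∈ G.rules, r.output.countP isNonterminal ≤ 1

/-- The terminals `0, 1` are the symbols number `0, 1`; nonterminal `i` is the symbol number
`i + 2`. -/
def symbolIndex {n : ℕ} : Symbol Bool (Fin n) → ℕ
  | .terminal b => b.toNat
  | .nonterminal i => i + 2

/-- A number, written by its binary digits `b` (least significant first) as `0b`, and closed by the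
separator `10`. -/
def encodeNat (k : ℕ) : List Bool :=
  k.bits.flatMap (fun b => [false, b]) ++ [true, false]

/-- A list of numbers, closed by the separator `11`. -/
def encodeRow (l : List ℕ) : List Bool :=
  l.flatMap encodeNat ++ [true, true]

/-- The row of the rule `A → α`: the numbers of `A` and of the symbols of `α`. -/
def ruleRow {n : ℕ} (r : ContextFreeRule Bool (Fin n)) : List ℕ :=
  symbolIndex (n := n) (.nonterminal r.input) :: r.output.map symbolIndex

/-- The rows of a grammar: number of nonterminals and start symbol, then one row for each rule. -/
def rows (G : CFG) : List (List ℕ) :=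
  [G.numNT, symbolIndex (.nonterminal G.start)] :: G.rules.map ruleRow

/-- The binary code of a grammar. -/
def encode (G : CFG) : List Bool :=
  G.rows.flatMap encodeRow

theorem encodeBits_inj {l m s t : List Bool}
    (h : l.flatMap (fun b => [false, b]) ++ true :: false :: s =
      m.flatMap (fun b => [false, b]) ++ true :: false :: t) : l = m ∧ s = t := by
  induction l generalizing m with
  | nil => cases m <;> simp_all
  | cons a l ih =>
    cases m with
    | nil => simp at h
    | cons b m =>
      simp only [List.flatMap_cons, List.cons_append, List.nil_append, List.cons.injEq,
        true_and] at h
      obtain ⟨rfl, h⟩ := h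
      obtain ⟨rfl, rfl⟩ := ih h
      exact ⟨rfl, rfl⟩

theorem encodeNat_inj {a b : ℕ} {s t : List Bool} (h : encodeNat a ++ s = encodeNat b ++ t) :
    a = b ∧ s = t := by
  simp only [encodeNat, List.append_assoc, List.cons_append, List.nil_append] at h
  obtain ⟨h1, h2⟩ := encodeBits_inj h
  refine ⟨?_, h2⟩
  have h3 : Nat.digits 2 a = Nat.digits 2 b := by
    rw [Nat.digits_two_eq_bits, Nat.digits_two_eq_bits, h1]
  exact Nat.digits_inj_iff.1 h3

theorem encodeNat_ne {a : ℕ} {s t : List Bool} : encodeNat a ++ s ≠ true :: true :: t := by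
  intro h
  rcases hb : a.bits with _ | ⟨b, l⟩ <;> simp [encodeNat, hb] at h

theorem encodeRow_inj {l m : List ℕ} {s t : List Bool} (h : encodeRow l ++ s = encodeRow m ++ t) :
    l = m ∧ s = t := by
  simp only [encodeRow, List.append_assoc, List.cons_append, List.nil_append] at h
  induction l generalizing m with
  | nil =>
    cases m with
    | nil => simpa using h
    | cons b m =>
      simp only [List.flatMap_cons, List.flatMap_nil, List.nil_append, List.append_assoc] at h
      exact absurd h.symm encodeNat_ne
  | cons a l ih =>
    cases m with
    | nil =>
      simp only [List.flatMap_cons, List.flatMap_nil, List.nil_append, List.append_assoc] at h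
      exact absurd h encodeNat_ne
    | cons b m =>
      simp only [List.flatMap_cons, List.append_assoc] at h
      obtain ⟨rfl, h'⟩ := encodeNat_inj h
      obtain ⟨rfl, rfl⟩ := ih h'
      exact ⟨rfl, rfl⟩

theorem encodeRow_ne_nil {l : List ℕ} {s : List Bool} : encodeRow l ++ s ≠ [] := by
  simp [encodeRow]

theorem encodeRows_inj {l m : List (List ℕ)} (h : l.flatMap encodeRow = m.flatMap encodeRow) :
    l = m := by
  induction l generalizing m with
  | nil =>
    cases m with
    | nil => rfl
    | cons b m => exact absurd h.symm encodeRow_ne_nil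
  | cons a l ih =>
    cases m with
    | nil => exact absurd h encodeRow_ne_nil
    | cons b m =>
      simp only [List.flatMap_cons] at h
      obtain ⟨rfl, h'⟩ := encodeRow_inj h
      rw [ih h']

theorem symbolIndex_injective {n : ℕ} : Function.Injective (symbolIndex (n := n)) := by
  rintro (a | a) (b | b) h
  · cases a <;> cases b <;> simp_all [symbolIndex]
  · cases a <;> simp [symbolIndex] at h
  · cases b <;> simp [symbolIndex] at h
  · simp only [symbolIndex, Nat.add_right_cancel_iff] at h
    rw [Fin.ext h]

theorem ruleRow_injective {n : ℕ} : Function.Injective (ruleRow (n := n)) := by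
  rintro ⟨a, u⟩ ⟨b, v⟩ h
  simp only [ruleRow, List.cons.injEq] at h
  have h1 := symbolIndex_injective h.1
  have h2 := (List.map_injective_iff.2 symbolIndex_injective) h.2
  cases h1
  cases h2
  rfl

/-- A code determines the grammar, so that the notions below are well defined on codes. -/
theorem encode_injective : Function.Injective encode := by
  rintro ⟨n, S, P, hP⟩ ⟨n', S', P', hP'⟩ h
  have h := encodeRows_inj h
  simp only [rows, List.cons.injEq] at h
  obtain ⟨⟨rfl, h1, -⟩, h2⟩ := h
  have h1 := symbolIndex_injective h1
  have h2 := (List.map_injective_iff.2 ruleRow_injective) h2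
  cases h1
  cases h2
  rfl

end CFG

open Classical in
/-- The encoding system of context-free grammars: the code of `G` represents the indicator function
of the language of `G`; strings that are not codes represent the empty language. -/
noncomputable def cfgEncoding (p x : List Bool) : Bool :=
  decide (∃ G : CFG, G.encode = p ∧ x ∈ G.toGrammar.language)

open Classical in
/-- The encoding system of linear context-free grammars: strings that are not codes of linear
grammars represent the empty language. -/
noncomputable def linearCFGEncoding (p x : List Bool) : Bool :=
  decide (∃ G : CFG, G.IsLinear ∧ G.encode = p ∧ x ∈ G.toGrammar.language)

/-- `C` is a size complexity measure of grammars: `C(⟨G⟩) = |N| + |T| + |P|`. Nothing is required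
of the values of `C` on strings that are not codes. -/
def IsCFGSizeMeasure (C : List Bool → ℕ) : Prop :=
  ∀ G : CFG, C G.encode = G.size

theorem exists_isCFGSizeMeasure : ∃ C, IsCFGSizeMeasure C :=
  ⟨Function.extend CFG.encode CFG.size List.length, CFG.encode_injective.extend_apply _ _⟩

theorem cfgEncoding_encode (G : CFG) (x : List Bool) :
    cfgEncoding G.encode x = true ↔ x ∈ G.toGrammar.language := by
  simp only [cfgEncoding, decide_eq_true_eq]
  exact ⟨fun ⟨_, h, hx⟩ => CFG.encode_injective h ▸ hx, fun h => ⟨G, rfl, h⟩⟩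

theorem linearCFGEncoding_encode (G : CFG) (x : List Bool) :
    linearCFGEncoding G.encode x = true ↔ G.IsLinear ∧ x ∈ G.toGrammar.language := by
  simp only [linearCFGEncoding, decide_eq_true_eq]
  exact ⟨fun ⟨_, hl, h, hx⟩ => CFG.encode_injective h ▸ ⟨hl, hx⟩, fun h => ⟨G, h.1, rfl, h.2⟩⟩

end LengthGen

/-! The negative claims are a quantitative form of the undecidability of universality for linear
grammars. For every computable `h` there are a number `c` and a linear grammar of size at most `c`
that generates all words of length at most `h c`, but not all words
(`exists_isLinear_forall_mem_language`). A grammar for all words also has size at most `c`. The two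
indicator functions have the same training set at length `h c`, so a learner gives the same answer
on both and cannot be right on both (`exists_indistinguishable`, `eq_of_learnsAt`). Hence `h` bounds
neither the length complexity nor a sufficient training length.

The grammar generates the words that are not halting histories of a register machine started in a
fixed configuration. The machine computes a fast-growing function related to `h`. Register contents
are written in unary, so a history is at least as long as the output, and every shorter word is
generated; the true history is the missing word. Three points make this work. (a) A history is
refuted by one local error, and each kind of error is recognised by a linear grammar: the only
nonlocal comparison is between a register and the same register one step later. With stacks stored
as base-five numbers these are related by `b = k * a + s` or `a = k * b + s`, and a mismatch is
generated by growing the two unary blocks from outside inwards. (b) Linear grammars are produced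
from rational expressions over pairs of words (`PairExp`), whose `cost` bounds the size of the
grammar (`size_toCFG_le`, `mem_language_toCFG`). (c) The machine is fixed, and only the initial
configuration depends on the input `k`. It contributes at most a constant times `(k + 1) ^ 3` to the
size, so the size is below `(k + 1) ^ 4` for a suitable `k`, and the machine can be made to compute
a value above `h ((k + 1) ^ 4)`. The machine comes from the four-stack machine that evaluates
partial recursive code (`exists_regMachine`).

For the positive claims, membership in the language of a coded grammar is primitive recursive, by
saturating the finite set of facts "this symbol derives this factor of the word"
(`rowYields_iff_mem_saturate`). Currying then gives the encoding systems, and learning in the limit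
is identification by enumeration (`admitsLimit_of_primrec`). -/

namespace LengthGen

/-! ### Parse-tree semantics of grammars -/

/-- The words derivable from a sentential form, generated along leftmost parse trees: `P X α` says
that `X` may be replaced by `α`, and `τ` embeds the terminals into the symbols. -/
inductive Yields {S T : Type*} (P : S → List S → Prop) (τ : T → S) : List S → List T → Prop
  | nil : Yields P τ [] []
  | terminal (b : T) {β : List S} {v : List T} :
      Yields P τ β v → Yields P τ (τ b :: β) (b :: v)
  | rule {X : S} {α β : List S} {u v : List T} :
      P X α → Yields P τ α u → Yields P τ β v → Yields P τ (X :: β) (u ++ v)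

namespace Yields

variable {S S' T : Type*} {P : S → List S → Prop} {τ : T → S}

theorem append {α β : List S} {u v : List T} (h : Yields P τ α u) (h' : Yields P τ β v) :
    Yields P τ (α ++ β) (u ++ v) := by
  induction h with
  | nil => exact h'
  | terminal b _ ih => exact .terminal b ih
  | rule hP h1 _ _ ih =>
    rw [List.append_assoc]
    exact .rule hP h1 ih

theorem exists_of_append {α β : List S} {w : List T} (h : Yields P τ (α ++ β) w) :
    ∃ u v, w = u ++ v ∧ Yields P τ α u ∧ Yields P τ β v := by
  induction α generalizing w with
  | nil => exact ⟨[], w, rfl, .nil, h⟩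
  | cons X α ih =>
    rw [List.cons_append] at h
    cases h with
    | terminal b h =>
      obtain ⟨u, v, rfl, h1, h2⟩ := ih h
      exact ⟨_ :: u, v, rfl, .terminal b h1, h2⟩
    | rule hP h1 h =>
      obtain ⟨u', v', rfl, h2, h3⟩ := ih h
      exact ⟨_ ++ u', v', by simp, .rule hP h1 h2, h3⟩

theorem map_terminal (w : List T) : Yields P τ (w.map τ) w := by
  induction w with
  | nil => exact .nil
  | cons b w ih => exact .terminal b ih

/-- The rules of `P'` are exactly the images of the rules of `P`, so a derivation that starts in the
image of `f` never leaves it. This renaming is used twice: from grammar symbols to symbol numbers,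
and from numbered nonterminals to stacks of expressions. -/
theorem map_iff {f : S → S'} (hf : Function.Injective f) {P' : S' → List S' → Prop}
    (hP : ∀ X α, P' X α ↔ ∃ Y β, P Y β ∧ f Y = X ∧ β.map f = α) {α : List S} {w : List T} :
    Yields P' (f ∘ τ) (α.map f) w ↔ Yields P τ α w := by
  constructor
  · intro h
    generalize hα : α.map f = α' at h
    induction h generalizing α with
    | nil =>
      rw [List.map_eq_nil_iff] at hα
      subst hα
      exact .nil
    | terminal b _ ih =>
      obtain ⟨X, β, rfl, h1, rfl⟩ := List.map_eq_cons_iff.1 hα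
      cases hf h1
      exact .terminal b (ih rfl)
    | rule hX _ _ ih1 ih2 =>
      obtain ⟨X, β, rfl, rfl, rfl⟩ := List.map_eq_cons_iff.1 hα
      obtain ⟨Y, γ, hY, h1, rfl⟩ := (hP _ _).1 hX
      cases hf h1
      exact .rule hY (ih1 rfl) (ih2 rfl)
  · intro h
    induction h with
    | nil => exact .nil
    | terminal b _ ih => exact .terminal (τ := f ∘ τ) b ih
    | rule hX _ _ ih1 ih2 => exact .rule ((hP _ _).2 ⟨_, _, hX, rfl, rfl⟩) ih1 ih2

end Yields

/-- `X → α` is a rule of the grammar. -/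
def IsRule {T : Type*} (g : ContextFreeGrammar T) (X : Symbol T g.NT) (α : List (Symbol T g.NT)) :
    Prop :=
  ∃ r ∈ g.rules, X = .nonterminal r.input ∧ α = r.output

/-- Parse trees and rewriting sequences agree. In the backward direction the first rewriting step is
undone: the yield is split at the replaced right-hand side, which is then put under its nonterminal.
-/
theorem yields_iff_derives {T : Type*} {g : ContextFreeGrammar T} {α : List (Symbol T g.NT)}
    {w : List T} :
    Yields (IsRule g) Symbol.terminal α w ↔ g.Derives α (w.map Symbol.terminal) := by
  constructor
  · intro h
    induction h with
    | nil => exact .refl _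
    | terminal b _ ih => simpa using ih.append_left [Symbol.terminal b]
    | @rule X α β u v hX _ _ ih1 ih2 =>
      obtain ⟨r, hr, rfl, rfl⟩ := hX
      have h1 : g.Produces (.nonterminal r.input :: β) (r.output ++ β) :=
        ⟨r, hr, .head β⟩
      refine h1.trans_derives ((ih1.append_right β).trans ?_)
      rw [List.map_append]
      exact ih2.append_left _
  · intro h
    induction h using Relation.ReflTransGen.head_induction_on with
    | refl => exact Yields.map_terminal w
    | head h1 _ ih =>
      obtain ⟨r, hr, h1⟩ := h1
      obtain ⟨p, q, rfl, rfl⟩ := h1.exists_parts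
      obtain ⟨u, v, rfl, h2, h3⟩ := ih.exists_of_append
      obtain ⟨u', v', rfl, h4, h5⟩ := h2.exists_of_append
      have h6 : Yields (IsRule g) Symbol.terminal [.nonterminal r.input] v' := by
        simpa using Yields.rule ⟨r, hr, rfl, rfl⟩ h5 .nil
      exact (h4.append h6).append h3

theorem mem_language_iff_yields {T : Type*} {g : ContextFreeGrammar T} {w : List T} :
    w ∈ g.language ↔ Yields (IsRule g) Symbol.terminal [.nonterminal g.initial] w :=
  yields_iff_derives.symm

/-! ### Deciding membership by saturation -/

section Saturation

variable (rows : List (List ℕ))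

/-- The terminals `0, 1` as symbol numbers. -/
def terminalIndex (b : Bool) : ℕ := b.toNat

/-- Derivability in the grammar whose rule `X → α` is the row `X :: α`. -/
abbrev RowYields : List ℕ → List Bool → Prop :=
  Yields (fun X α => X :: α ∈ rows) terminalIndex

/-- What may be left of `w` after a prefix is consumed by the symbols `α`, where the set `F` lists
the words that a symbol can consume. -/
def remainders (F : List (ℕ × List Bool)) (α : List ℕ) (w : List Bool) : List (List Bool) :=
  α.foldl (fun R X => R.flatMap fun v =>
    ((List.range (v.length + 1)).filter fun i => decide ((X, v.take i) ∈ F)).map fun i =>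
      v.drop i) [w]

/-- The fact `X ⇒ w` follows from the facts in `F` by one rule. -/
def OneStep (F : List (ℕ × List Bool)) (q : ℕ × List Bool) : Prop :=
  q = (0, [false]) ∨ q = (1, [true]) ∨
    ∃ r ∈ rows, r.head? = some q.1 ∧ [] ∈ remainders F r.tail q.2

/-- All pairs of a symbol of the grammar and a factor of `x`. -/
def candidates (x : List Bool) : List (ℕ × List Bool) :=
  (0 :: 1 :: rows.flatten).flatMap fun X =>
    (List.range (x.length + 1)).flatMap fun i =>
      (List.range (x.length + 1)).map fun j => (X, (x.drop i).take j)

open Classical in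
/-- One round of saturation. -/
noncomputable def saturateStep (x : List Bool) (F : List (ℕ × List Bool)) :
    List (ℕ × List Bool) :=
  (candidates rows x).filter fun q => decide (OneStep rows F q)

/-- The facts obtained in `k` rounds of saturation. -/
noncomputable def saturate (x : List Bool) (k : ℕ) : List (ℕ × List Bool) :=
  (saturateStep rows x)^[k] []

variable {rows}

/-- The fold distributes over the words in its initial list. This is what allows the first symbol of
a right-hand side to be split off in `mem_remainders_cons`. -/
theorem mem_remainders_append {F : List (ℕ × List Bool)} {α : List ℕ} {R : List (List Bool)}
    {v : List Bool} :
    v ∈ α.foldl (fun R X => R.flatMap fun v =>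
        ((List.range (v.length + 1)).filter fun i => decide ((X, v.take i) ∈ F)).map fun i =>
          v.drop i) R ↔ ∃ w ∈ R, v ∈ remainders F α w := by
  induction α generalizing R with
  | nil => simp [remainders]
  | cons X α ih =>
    simp only [remainders, List.foldl_cons]
    rw [ih]
    simp only [ih, List.flatMap_singleton, List.mem_flatMap]
    constructor
    · rintro ⟨w, ⟨a, ha, h⟩, h'⟩
      exact ⟨a, ha, w, h, h'⟩
    · rintro ⟨a, ha, w, h, h'⟩
      exact ⟨w, ⟨a, ha, h⟩, h'⟩

theorem mem_remainders_nil {F : List (ℕ × List Bool)} {v w : List Bool} :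
    v ∈ remainders F [] w ↔ v = w := by
  simp [remainders]

theorem mem_remainders_cons {F : List (ℕ × List Bool)} {X : ℕ} {α : List ℕ} {v w : List Bool} :
    v ∈ remainders F (X :: α) w ↔ ∃ u t, w = u ++ t ∧ (X, u) ∈ F ∧ v ∈ remainders F α t := by
  rw [remainders, List.foldl_cons, mem_remainders_append]
  simp only [List.flatMap_singleton, List.mem_map, List.mem_filter, List.mem_range,
    decide_eq_true_eq]
  constructor
  · rintro ⟨t, ⟨i, ⟨_, hi⟩, rfl⟩, h⟩
    exact ⟨w.take i, w.drop i, (List.take_append_drop i w).symm, hi, h⟩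
  · rintro ⟨u, t, rfl, hu, h⟩
    exact ⟨t, ⟨u.length, ⟨by simp, by simpa using hu⟩, by simp⟩, h⟩

theorem mem_candidates {x : List Bool} {q : ℕ × List Bool} :
    q ∈ candidates rows x ↔ (q.1 = 0 ∨ q.1 = 1 ∨ ∃ r ∈ rows, q.1 ∈ r) ∧ q.2 <:+: x := by
  obtain ⟨X, w⟩ := q
  simp only [candidates, List.mem_flatMap, List.mem_cons, List.mem_flatten, List.mem_map,
    List.mem_range, Prod.mk.injEq]
  constructor
  · rintro ⟨Y, hY, i, -, j, -, rfl, rfl⟩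
    exact ⟨hY, (List.take_prefix _ _).isInfix.trans (List.drop_suffix _ _).isInfix⟩
  · rintro ⟨hX, s, t, rfl⟩
    refine ⟨X, hX, s.length, ?_, w.length, ?_, rfl, by simp⟩ <;> (simp only [List.length_append]; omega)

theorem rowYields_of_remainders {F : List (ℕ × List Bool)}
    (hF : ∀ q ∈ F, RowYields rows [q.1] q.2) {α : List ℕ} {w : List Bool}
    (h : [] ∈ remainders F α w) : RowYields rows α w := by
  induction α generalizing w with
  | nil =>
    cases mem_remainders_nil.1 h
    exact .nil
  | cons X α ih =>
    obtain ⟨u, t, rfl, hu, ht⟩ := mem_remainders_cons.1 h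
    exact (hF _ hu).append (ih ht)

theorem rowYields_of_oneStep {F : List (ℕ × List Bool)}
    (hF : ∀ q ∈ F, RowYields rows [q.1] q.2) {q : ℕ × List Bool} (h : OneStep rows F q) :
    RowYields rows [q.1] q.2 := by
  rcases h with rfl | rfl | ⟨r, hr, h1, h2⟩
  · exact .terminal (τ := terminalIndex) false .nil
  · exact .terminal (τ := terminalIndex) true .nil
  · obtain ⟨α, rfl⟩ : ∃ α, r = q.1 :: α := by
      cases r with
      | nil => simp at h1
      | cons a l => exact ⟨l, by simpa using h1⟩
    have := Yields.rule (P := fun X α => X :: α ∈ rows) (τ := terminalIndex) hr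
      (rowYields_of_remainders hF h2) .nil
    simpa using this

theorem saturate_succ (x : List Bool) (k : ℕ) :
    saturate rows x (k + 1) = saturateStep rows x (saturate rows x k) :=
  Function.iterate_succ_apply' _ _ _

theorem rowYields_of_mem_saturate {x : List Bool} {k : ℕ} {q : ℕ × List Bool}
    (h : q ∈ saturate rows x k) : RowYields rows [q.1] q.2 := by
  induction k generalizing q with
  | zero => simp [saturate] at h
  | succ k ih =>
    rw [saturate_succ, saturateStep, List.mem_filter] at h
    exact rowYields_of_oneStep (fun q hq => ih hq) (by simpa using h.2)

/-- Completeness of saturation: a parse tree of a factor of `x` uses only factors of `x`, so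
induction on the tree finds each of its facts in any `F` closed under `OneStep` within the
candidates. -/
theorem remainders_of_rowYields {x : List Bool} {F : List (ℕ × List Bool)}
    (hF : ∀ q ∈ candidates rows x, OneStep rows F q → q ∈ F) {α : List ℕ} {w : List Bool}
    (h : RowYields rows α w) (hw : w <:+: x) : [] ∈ remainders F α w := by
  induction h with
  | nil => exact mem_remainders_nil.2 rfl
  | @terminal b β v _ ih =>
    refine mem_remainders_cons.2 ⟨[b], v, rfl, ?_, ih ((List.suffix_cons b v).isInfix.trans hw)⟩
    refine hF _ (mem_candidates.2 ⟨?_, List.IsInfix.trans ⟨[], v, rfl⟩ hw⟩) ?_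
    · cases b <;> simp [terminalIndex]
    · cases b <;> simp [terminalIndex, OneStep]
  | @rule X α β u v hX _ _ ih1 ih2 =>
    have hu : u <:+: x := (List.prefix_append u v).isInfix.trans hw
    have hv : v <:+: x := (List.suffix_append u v).isInfix.trans hw
    refine mem_remainders_cons.2 ⟨u, v, rfl, ?_, ih2 hv⟩
    exact hF _ (mem_candidates.2 ⟨.inr (.inr ⟨_, hX, by simp⟩), hu⟩)
      (.inr (.inr ⟨_, hX, rfl, ih1 hu⟩))

theorem remainders_mono {F F' : List (ℕ × List Bool)} (h : F ⊆ F') {α : List ℕ}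
    {v w : List Bool} (hv : v ∈ remainders F α w) : v ∈ remainders F' α w := by
  induction α generalizing w with
  | nil => exact hv
  | cons X α ih =>
    obtain ⟨u, t, rfl, hu, ht⟩ := mem_remainders_cons.1 hv
    exact mem_remainders_cons.2 ⟨u, t, rfl, h hu, ih ht⟩

theorem OneStep.mono {F F' : List (ℕ × List Bool)} (h : F ⊆ F') {q : ℕ × List Bool}
    (hq : OneStep rows F q) : OneStep rows F' q :=
  hq.imp_right fun hq => hq.imp_right fun ⟨r, hr, h1, h2⟩ => ⟨r, hr, h1, remainders_mono h h2⟩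

theorem saturate_sublist_succ (x : List Bool) (k : ℕ) :
    (saturate rows x k).Sublist (saturate rows x (k + 1)) := by
  induction k with
  | zero => simp [saturate]
  | succ k ih =>
    rw [saturate_succ, saturate_succ x (k + 1)]
    refine List.monotone_filter_right _ fun q hq => ?_
    simp only [decide_eq_true_eq] at hq ⊢
    exact hq.mono ih.subset

/-- Rounds form an increasing chain of sublists, so a round that changes anything adds at least one
entry, and a round that changes nothing is followed only by such rounds. Since every round is a
sublist of the candidates, as many rounds as there are candidates suffice. -/
theorem saturate_stable_or (x : List Bool) (k : ℕ) :
    saturate rows x (k + 1) = saturate rows x k ∨ k + 1 ≤ (saturate rows x (k + 1)).length := by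
  induction k with
  | zero =>
    by_cases h : saturate rows x 1 = []
    · exact .inl h
    · exact .inr (List.length_pos_iff.2 h)
  | succ k ih =>
    by_cases h : saturate rows x (k + 1 + 1) = saturate rows x (k + 1)
    · exact .inl h
    rcases ih with ih | ih
    · exact absurd (by rw [saturate_succ x (k + 1), ih, ← saturate_succ, ih]) h
    · have h1 := saturate_sublist_succ (rows := rows) x (k + 1)
      have h2 := h1.length_le
      have h3 : (saturate rows x (k + 1)).length ≠ (saturate rows x (k + 1 + 1)).length :=
        fun h' => h (h1.eq_of_length h').symm
      exact .inr (by omega)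

theorem saturate_stable (x : List Bool) :
    saturate rows x ((candidates rows x).length + 1) =
      saturate rows x (candidates rows x).length := by
  rcases saturate_stable_or (rows := rows) x (candidates rows x).length with h | h
  · exact h
  · have : (saturate rows x ((candidates rows x).length + 1)).length ≤
        (candidates rows x).length := by
      rw [saturate_succ]
      exact List.length_filter_le _ _
    omega

/-- Membership is decided by saturation. -/
theorem rowYields_iff_mem_saturate {x : List Bool} {s : ℕ} :
    RowYields rows [s] x ↔ (s, x) ∈ saturate rows x (candidates rows x).length := by
  refine ⟨fun h => ?_, rowYields_of_mem_saturate⟩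
  have hF : ∀ q ∈ candidates rows x,
      OneStep rows (saturate rows x (candidates rows x).length) q →
        q ∈ saturate rows x (candidates rows x).length := by
    intro q hq h
    rw [← saturate_stable, saturate_succ]
    exact List.mem_filter.2 ⟨hq, by simpa using h⟩
  obtain ⟨u, t, h1, h2, h3⟩ := mem_remainders_cons.1
    (remainders_of_rowYields hF h List.infix_rfl)
  cases mem_remainders_nil.1 h3
  rw [List.append_nil] at h1
  exact h1 ▸ h2

end Saturation

/-! ### Saturation is primitive recursive -/

section Primrec

variable {α β : Type*} [Primcodable α] [Primcodable β]

theorem primrecPred_exists_mem {f : α → List β} {p : α → β → Prop} (hf : Primrec f)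
    (hp : PrimrecPred fun c : α × β => p c.1 c.2) : PrimrecPred fun a => ∃ b ∈ f a, p a b := by
  have h : PrimrecRel fun (b : β) (a : α) => p a b :=
    hp.comp (Primrec.snd.pair Primrec.fst)
  exact h.exists_mem_list.comp hf .id

theorem primrecPred_forall_mem {f : α → List β} {p : α → β → Prop} (hf : Primrec f)
    (hp : PrimrecPred fun c : α × β => p c.1 c.2) : PrimrecPred fun a => ∀ b ∈ f a, p a b := by
  have h : PrimrecRel fun (b : β) (a : α) => p a b :=
    hp.comp (Primrec.snd.pair Primrec.fst)
  exact h.forall_mem_list.comp hf .id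

theorem primrec_filter {f : α → List β} {p : α → β → Prop} [∀ a b, Decidable (p a b)]
    (hf : Primrec f) (hp : PrimrecPred fun c : α × β => p c.1 c.2) :
    Primrec fun a => (f a).filter fun b => decide (p a b) := by
  have h : PrimrecRel fun (b : β) (a : α) => p a b :=
    hp.comp (Primrec.snd.pair Primrec.fst)
  let _ : DecidableRel fun (b : β) (a : α) => p a b := fun b a => inferInstance
  exact h.listFilter.comp hf .id

theorem primrecPred_mem {f : α → β} {g : α → List β} (hf : Primrec f) (hg : Primrec g) :
    PrimrecPred fun a => f a ∈ g a :=
  (primrecPred_exists_mem (p := fun a b => b = f a) hg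
    (Primrec.eq.comp .snd (hf.comp .fst))).of_eq fun a => by simp

open Primrec in
theorem primrec_remainders {f : α → List (ℕ × List Bool)} {g : α → List ℕ} {h : α → List Bool}
    (hf : Primrec f) (hg : Primrec g) (hh : Primrec h) :
    Primrec fun a => remainders (f a) (g a) (h a) := by
  refine list_foldl (h := fun a (c : List (List Bool) × ℕ) => c.1.flatMap fun v =>
    ((List.range (v.length + 1)).filter fun i => decide ((c.2, v.take i) ∈ f a)).map fun i =>
      v.drop i) hg (list_cons.comp hh (const [])) ?_
  refine list_flatMap (fst.comp snd) ?_
  refine list_map (f := fun c : (α × List (List Bool) × ℕ) × List Bool =>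
    (List.range (c.2.length + 1)).filter fun i => decide ((c.1.2.2, c.2.take i) ∈ f c.1.1)) ?_ ?_
  · refine primrec_filter (list_range.comp (succ.comp (list_length.comp snd))) ?_
    exact primrecPred_mem
      ((snd.comp (snd.comp (fst.comp fst))).pair (list_take.comp snd (snd.comp fst)))
      (hf.comp (fst.comp (fst.comp fst)))
  · exact list_drop.comp snd (snd.comp fst)

open Primrec in
theorem primrecPred_oneStep {f : α → List (List ℕ)} {g : α → List (ℕ × List Bool)}
    {h : α → ℕ × List Bool} (hf : Primrec f) (hg : Primrec g) (hh : Primrec h) :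
    PrimrecPred fun a => OneStep (f a) (g a) (h a) := by
  refine (Primrec.eq.comp hh (const _)).or ((Primrec.eq.comp hh (const _)).or ?_)
  refine primrecPred_exists_mem hf (.and ?_ ?_)
  · exact Primrec.eq.comp (list_head?.comp snd) (option_some.comp (fst.comp (hh.comp fst)))
  · exact primrecPred_mem (const [])
      (primrec_remainders (hg.comp fst) (list_tail.comp snd) (snd.comp (hh.comp fst)))

open Primrec in
theorem primrec_candidates {f : α → List (List ℕ)} {g : α → List Bool}
    (hf : Primrec f) (hg : Primrec g) : Primrec fun a => candidates (f a) (g a) := by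
  refine list_flatMap (list_cons.comp (const 0) (list_cons.comp (const 1)
    (list_flatten.comp hf))) ?_
  refine list_flatMap (list_range.comp (succ.comp (list_length.comp (hg.comp fst)))) ?_
  refine list_map (list_range.comp (succ.comp (list_length.comp (hg.comp (fst.comp fst))))) ?_
  exact (snd.comp (fst.comp fst)).pair (list_take.comp snd
    (list_drop.comp (snd.comp fst) (hg.comp (fst.comp (fst.comp fst)))))

open Primrec in
theorem primrecPred_rowYields {f : α → List (List ℕ)} {s : α → ℕ} {g : α → List Bool}
    (hf : Primrec f) (hs : Primrec s) (hg : Primrec g) :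
    PrimrecPred fun a => RowYields (f a) [s a] (g a) := by
  classical
  have hstep : Primrec₂ fun (a : α) F => saturateStep (f a) (g a) F :=
    primrec_filter (primrec_candidates (hf.comp fst) (hg.comp fst))
      (primrecPred_oneStep (hf.comp (fst.comp fst)) (snd.comp fst) snd)
  have hsat : Primrec fun a => saturate (f a) (g a) (candidates (f a) (g a)).length :=
    nat_iterate (list_length.comp (primrec_candidates hf hg)) (const []) hstep
  exact (primrecPred_mem (hs.pair hg) hsat).of_eq fun a => rowYields_iff_mem_saturate.symm

end Primrec

/-! ### Decoding of grammars -/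

section Decoding

/-- The number with the binary digits `l`, least significant first. -/
def ofBits (l : List Bool) : ℕ :=
  l.foldr (fun b n => b.toNat + 2 * n) 0

/-- Reading one bit of a code. The state consists of a pending bit, the digits of the current
number, the current row, and the finished rows. -/
def parseStep (s : Option Bool × List Bool × List ℕ × List (List ℕ)) (b : Bool) :
    Option Bool × List Bool × List ℕ × List (List ℕ) :=
  bif s.1.isNone then (some b, s.2)
  else bif !s.1.getD true then (none, s.2.1 ++ [b], s.2.2)
  else bif b then (none, [], [], s.2.2.2 ++ [s.2.2.1])
  else (none, [], s.2.2.1 ++ [ofBits s.2.1], s.2.2.2)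

/-- The rows of which `p` is the code, if there are any. -/
def parse (p : List Bool) : List (List ℕ) :=
  (p.foldl parseStep (none, [], [], [])).2.2.2

theorem ofBits_bits (k : ℕ) : ofBits k.bits = k := by
  induction k using Nat.binaryRec' with
  | zero => rfl
  | bit b n h ih =>
    rw [Nat.bits_append_bit _ _ h]
    change b.toNat + 2 * ofBits n.bits = _
    rw [ih, Nat.bit_val]
    omega

theorem foldl_parseStep_bits (l a : List Bool) (r : List ℕ) (R : List (List ℕ)) :
    (l.flatMap fun b => [false, b]).foldl parseStep (none, a, r, R) = (none, a ++ l, r, R) := by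
  induction l generalizing a with
  | nil => simp
  | cons b l ih =>
    rw [List.flatMap_cons, List.foldl_append]
    have : [false, b].foldl parseStep (none, a, r, R) = (none, a ++ [b], r, R) := rfl
    rw [this, ih]
    simp

theorem foldl_parseStep_encodeNat (k : ℕ) (r : List ℕ) (R : List (List ℕ)) :
    (CFG.encodeNat k).foldl parseStep (none, [], r, R) = (none, [], r ++ [k], R) := by
  rw [CFG.encodeNat, List.foldl_append, foldl_parseStep_bits]
  simp [parseStep, ofBits_bits]

theorem foldl_parseStep_encodeRow (l : List ℕ) (R : List (List ℕ)) :
    (CFG.encodeRow l).foldl parseStep (none, [], [], R) = (none, [], [], R ++ [l]) := by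
  have h : ∀ (l r : List ℕ), (l.flatMap CFG.encodeNat).foldl parseStep (none, [], r, R) =
      (none, [], r ++ l, R) := by
    intro l
    induction l with
    | nil => simp
    | cons k l ih =>
      intro r
      rw [List.flatMap_cons, List.foldl_append, foldl_parseStep_encodeNat, ih]
      simp
  rw [CFG.encodeRow, List.foldl_append, h]
  simp [parseStep]

theorem parse_flatMap_encodeRow (rows : List (List ℕ)) :
    parse (rows.flatMap CFG.encodeRow) = rows := by
  have h : ∀ rows R : List (List ℕ),
      (rows.flatMap CFG.encodeRow).foldl parseStep (none, [], [], R) =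
        (none, [], [], R ++ rows) := by
    intro rows
    induction rows with
    | nil => simp
    | cons r rows ih =>
      intro R
      rw [List.flatMap_cons, List.foldl_append, foldl_parseStep_encodeRow, ih]
      simp
  rw [parse, h, List.nil_append]

/-- The rows are those of a context-free grammar. -/
def WellFormed (rows : List (List ℕ)) : Prop :=
  (rows.headI.length = 2 ∧ 2 ≤ rows.headI.getI 1 ∧
      rows.headI.getI 1 < rows.headI.headI + 2) ∧
    rows.tail.Nodup ∧
    ∀ r ∈ rows.tail, r ≠ [] ∧ 2 ≤ r.headI ∧ ∀ y ∈ r, y < rows.headI.headI + 2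

/-- Every right-hand side contains at most one number of a nonterminal. -/
def LinearRows (rows : List (List ℕ)) : Prop :=
  ∀ r ∈ rows.tail, (r.tail.filter fun y => decide (2 ≤ y)).length ≤ 1

theorem symbolIndex_lt {n : ℕ} (X : Symbol Bool (Fin n)) : CFG.symbolIndex X < n + 2 := by
  cases X with
  | terminal b => cases b <;> simp [CFG.symbolIndex]
  | nonterminal i => simp [CFG.symbolIndex]

theorem exists_symbolIndex {n y : ℕ} (hy : y < n + 2) :
    ∃ X : Symbol Bool (Fin n), CFG.symbolIndex X = y := by
  rcases y with _ | _ | y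
  · exact ⟨.terminal false, rfl⟩
  · exact ⟨.terminal true, rfl⟩
  · exact ⟨.nonterminal ⟨y, by omega⟩, rfl⟩

theorem wellFormed_rows (G : CFG) : WellFormed G.rows := by
  refine ⟨⟨rfl, ?_, ?_⟩, G.nodup.map CFG.ruleRow_injective, ?_⟩
  · exact Nat.le_add_left _ _
  · exact symbolIndex_lt (.nonterminal G.start)
  · intro r hr
    obtain ⟨r, -, rfl⟩ := List.mem_map.1 hr
    refine ⟨by simp [CFG.ruleRow], Nat.le_add_left _ _, fun y hy => ?_⟩
    rcases List.mem_cons.1 hy with rfl | hy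
    · exact symbolIndex_lt _
    · obtain ⟨X, -, rfl⟩ := List.mem_map.1 hy
      exact symbolIndex_lt X

theorem exists_cfg_of_wellFormed {rows : List (List ℕ)} (h : WellFormed rows) :
    ∃ G : CFG, G.rows = rows := by
  obtain ⟨⟨h1, h2, h3⟩, h4, h5⟩ := h
  obtain ⟨_, rs, rfl⟩ : ∃ a rs, rows = a :: rs := by
    cases rows with
    | nil => simp at h1
    | cons a rs => exact ⟨a, rs, rfl⟩
  obtain ⟨n, s, rfl⟩ := List.length_eq_two.1 h1
  simp only [List.headI_cons, List.tail_cons, List.getI_cons_succ, List.getI_cons_zero]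
    at h2 h3 h4 h5
  have hr : ∀ r ∈ rs, ∃ r' : ContextFreeRule Bool (Fin n), CFG.ruleRow r' = r := by
    intro r hr
    obtain ⟨h6, h7, h8⟩ := h5 r hr
    obtain ⟨a, l, rfl⟩ := List.exists_cons_of_ne_nil h6
    rw [List.headI_cons] at h7
    have h9 := h8 a (by simp)
    have : ∀ y ∈ l, y ∈ Set.range (CFG.symbolIndex (n := n)) := fun y hy =>
      exists_symbolIndex (h8 y (by simp [hy]))
    obtain ⟨α, rfl⟩ : l ∈ Set.range (List.map (CFG.symbolIndex (n := n))) := by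
      rw [Set.range_list_map]
      exact this
    exact ⟨⟨⟨a - 2, by omega⟩, α⟩, by simp [CFG.ruleRow, CFG.symbolIndex]; omega⟩
  obtain ⟨P, rfl⟩ : rs ∈ Set.range (List.map (CFG.ruleRow (n := n))) := by
    rw [Set.range_list_map]
    exact hr
  refine ⟨⟨n, ⟨s - 2, by omega⟩, P, h4.of_map _⟩, ?_⟩
  simp [CFG.rows, CFG.symbolIndex]
  omega

/-- `parse` returns rows for every string, including non-codes. Encoding the result again and
comparing with `p` rejects those strings, so only the behaviour of `parse` on codes matters. -/
theorem exists_encode_eq_iff {p : List Bool} {Q : CFG → Prop} {Q' : List (List ℕ) → Prop}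
    (hQ : ∀ G : CFG, Q G ↔ Q' G.rows) :
    (∃ G : CFG, G.encode = p ∧ Q G) ↔
      (parse p).flatMap CFG.encodeRow = p ∧ WellFormed (parse p) ∧ Q' (parse p) := by
  constructor
  · rintro ⟨G, rfl, h⟩
    rw [CFG.encode, parse_flatMap_encodeRow]
    exact ⟨rfl, wellFormed_rows G, (hQ G).1 h⟩
  · rintro ⟨h1, h2, h3⟩
    obtain ⟨G, hG⟩ := exists_cfg_of_wellFormed h2
    exact ⟨G, by rw [CFG.encode, hG, h1], (hQ G).2 (hG ▸ h3)⟩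

theorem isLinear_iff (G : CFG) : G.IsLinear ↔ LinearRows G.rows := by
  have h : ∀ α : List (Symbol Bool (Fin G.numNT)), α.countP CFG.isNonterminal =
      ((α.map CFG.symbolIndex).filter fun y => decide (2 ≤ y)).length := by
    intro α
    rw [List.filter_map, List.length_map, List.countP_eq_length_filter]
    congr 2
    funext X
    cases X with
    | terminal b => cases b <;> simp [CFG.isNonterminal, CFG.symbolIndex]
    | nonterminal i => simp [CFG.isNonterminal, CFG.symbolIndex]
  simp [CFG.IsLinear, LinearRows, CFG.rows, CFG.ruleRow, h]

theorem mem_toGrammar_rules {G : CFG} (r : ContextFreeRule Bool (Fin G.numNT)) :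
    r ∈ G.toGrammar.rules ↔ r ∈ G.rules :=
  List.mem_toFinset (l := G.rules)

theorem mem_language_iff_rowYields (G : CFG) (x : List Bool) :
    x ∈ G.toGrammar.language ↔ RowYields G.rows.tail [G.rows.headI.getI 1] x := by
  rw [mem_language_iff_yields]
  have hτ : terminalIndex = CFG.symbolIndex (n := G.numNT) ∘ Symbol.terminal := rfl
  have := Yields.map_iff (P := IsRule G.toGrammar) (τ := Symbol.terminal)
    (f := CFG.symbolIndex (n := G.numNT)) CFG.symbolIndex_injective
    (P' := fun X α => X :: α ∈ G.rows.tail) (α := [.nonterminal G.start]) (w := x) (by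
      intro X α
      simp only [CFG.rows, List.tail_cons, List.mem_map, IsRule]
      constructor
      · rintro ⟨r, hr, h⟩
        simp only [CFG.ruleRow, List.cons.injEq] at h
        exact ⟨_, _, ⟨r, (mem_toGrammar_rules r).2 hr, rfl, rfl⟩, h.1, h.2⟩
      · rintro ⟨_, _, ⟨r, hr, rfl, rfl⟩, rfl, rfl⟩
        exact ⟨r, (mem_toGrammar_rules r).1 hr, rfl⟩)
  exact this.symm

open Primrec in
theorem primrec_ofBits : Primrec ofBits :=
  list_foldr (h := fun _ (c : Bool × ℕ) => c.1.toNat + 2 * c.2) .id (const 0)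
    (nat_add.comp ((dom_bool Bool.toNat).comp (fst.comp snd))
      (nat_mul.comp (const 2) (snd.comp snd)))

open Primrec in
theorem primrec_parseStep : Primrec₂ parseStep := by
  refine cond (dom_finite Option.isNone |>.comp (fst.comp fst))
    ((option_some.comp snd).pair (snd.comp fst)) ?_
  refine cond (Primrec.not.comp (option_getD.comp (fst.comp fst) (const true)))
    ((const none).pair ((list_concat.comp (fst.comp (snd.comp fst)) snd).pair
      (snd.comp (snd.comp fst)))) ?_
  refine cond snd ((const none).pair ((const []).pair ((const []).pair
    (list_concat.comp (snd.comp (snd.comp (snd.comp fst)))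
      (fst.comp (snd.comp (snd.comp fst))))))) ?_
  exact (const none).pair ((const []).pair ((list_concat.comp
    (fst.comp (snd.comp (snd.comp fst))) (primrec_ofBits.comp (fst.comp (snd.comp fst)))).pair
      (snd.comp (snd.comp (snd.comp fst)))))

open Primrec in
theorem primrec_parse : Primrec parse :=
  snd.comp (snd.comp (snd.comp (list_foldl (h := fun _ c => parseStep c.1 c.2) .id
    (const (none, [], [], [])) (primrec_parseStep.comp (fst.comp snd) (snd.comp snd)))))

open Primrec in
theorem primrec_bits : Primrec Nat.bits := by
  have : Primrec₂ fun (_ : Unit) (n : ℕ) => n.bits := by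
    -- Here `l` lists the values at all smaller arguments, so its length is the current argument and
    -- the entry at half that index holds the remaining bits.
    refine nat_strong_rec _ (g := fun _ l => bif decide (l.length = 0) then some [] else
      l[l.length / 2]?.map (List.cons (l.length % 2 == 1))) ?_ ?_
    · refine cond (Primrec.eq.comp (list_length.comp snd) (const 0)).decide (const _) ?_
      refine option_map (list_getElem?.comp snd
        (nat_div.comp (list_length.comp snd) (const 2))) ?_
      exact list_cons.comp (Primrec.beq.comp (nat_mod.comp
        (list_length.comp (snd.comp fst)) (const 2)) (const 1)) snd
    · intro _ n
      induction n using Nat.binaryRec' with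
      | zero => rfl
      | bit b n h _ =>
        have h0 : Nat.bit b n ≠ 0 := fun h' => by
          rw [Nat.bit_eq_zero_iff] at h'
          exact absurd (h h'.1) (by simp [h'.2])
        have h1 : Nat.bit b n / 2 = n := by rw [← Nat.div2_val, Nat.div2_bit]
        have h2 : n < Nat.bit b n := by
          rw [Nat.bit_val] at h0 ⊢
          cases b <;> simp at h0 ⊢ <;> omega
        rw [Nat.bits_append_bit _ _ h]
        simp [h0, h1, h2, Nat.bit_mod_two]
  exact this.comp (const ()) .id

open Primrec in
theorem primrec_encodeRow : Primrec CFG.encodeRow := by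
  have h : Primrec CFG.encodeNat :=
    list_append.comp (list_flatMap (primrec_bits.comp .id)
      ((dom_bool fun b => [false, b]).comp snd).to₂) (const _)
  exact list_append.comp (list_flatMap .id (h.comp snd).to₂) (const _)

open Primrec in
theorem primrecPred_nodup {α : Type*} [Primcodable α] :
    PrimrecPred (List.Nodup : List α → Prop) := by
  classical
  refine Primrec.primrecPred ((list_rec (f := fun l : List α => l) (g := fun _ => true)
    (h := fun _ c => (!decide (c.1 ∈ c.2.1)) && c.2.2) .id (const true) ?_).of_eq ?_)
  · exact Primrec.and.comp (Primrec.not.comp (primrecPred_mem (fst.comp snd)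
      (fst.comp (snd.comp snd))).decide) (snd.comp (snd.comp snd))
  · intro l
    induction l with
    | nil => simp
    | cons a l ih => simp_all

open Primrec in
theorem primrecPred_wellFormed : PrimrecPred WellFormed := by
  have hI : Primrec fun rows : List (List ℕ) => rows.headI := list_headI
  have hs : Primrec fun rows : List (List ℕ) => rows.headI.getI 1 := list_getI.comp hI (const 1)
  have hn : Primrec fun rows : List (List ℕ) => rows.headI.headI + 2 :=
    nat_add.comp (list_headI.comp hI) (const 2)
  refine ((Primrec.eq.comp (list_length.comp hI) (const 2)).and
    ((nat_le.comp (const 2) hs).and (nat_lt.comp hs hn))).and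
    ((primrecPred_nodup.comp list_tail).and (primrecPred_forall_mem list_tail
      ((Primrec.eq.comp snd (const [])).not.and ((nat_le.comp (const 2)
        (list_headI.comp snd)).and ?_))))
  exact primrecPred_forall_mem (p := fun (a : List (List ℕ) × List ℕ) y => y < a.1.headI.headI + 2)
    snd (nat_lt.comp snd (hn.comp (fst.comp fst)))

open Primrec in
theorem primrecPred_linearRows : PrimrecPred LinearRows := by
  refine primrecPred_forall_mem list_tail (nat_le.comp (list_length.comp ?_) (const 1))
  exact primrec_filter (p := fun (_ : List (List ℕ) × List ℕ) y => 2 ≤ y) (list_tail.comp snd)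
    (nat_le.comp (const 2) snd)

/-- The indicator function of the languages of the grammars in a primitive recursive class. -/
theorem primrec₂_of_iff_exists_encode {R : List Bool → List Bool → Bool} {Q : CFG → Prop}
    {Q' : List (List ℕ) → Prop} (hQ : ∀ G : CFG, Q G ↔ Q' G.rows) (hQ' : PrimrecPred Q')
    (hR : ∀ p x, R p x = true ↔ ∃ G : CFG, G.encode = p ∧ Q G ∧ x ∈ G.toGrammar.language) :
    Primrec₂ R := by
  classical
  have hparse := primrec_parse.comp (Primrec.fst (α := List Bool) (β := List Bool))
  have h : PrimrecPred fun c : List Bool × List Bool => R c.1 c.2 = true := by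
    refine PrimrecPred.of_eq (p := fun c : List Bool × List Bool =>
      (parse c.1).flatMap CFG.encodeRow = c.1 ∧ WellFormed (parse c.1) ∧ Q' (parse c.1) ∧
        RowYields (parse c.1).tail [(parse c.1).headI.getI 1] c.2) ?_ fun c => ?_
    · refine (Primrec.eq.comp (Primrec.list_flatMap hparse (primrec_encodeRow.comp .snd).to₂)
        .fst).and ((primrecPred_wellFormed.comp hparse).and ((hQ'.comp hparse).and ?_))
      exact primrecPred_rowYields (Primrec.list_tail.comp hparse)
        (Primrec.list_getI.comp (Primrec.list_headI.comp hparse) (.const 1)) .snd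
    · rw [hR, exists_encode_eq_iff (Q' := fun rows => Q' rows ∧
        RowYields rows.tail [rows.headI.getI 1] c.2)
        fun G => and_congr (hQ G) (mem_language_iff_rowYields G c.2)]
  exact h.decide.of_eq fun c => by simp

theorem primrec₂_cfgEncoding : Primrec₂ cfgEncoding :=
  primrec₂_of_iff_exists_encode (Q := fun _ => True) (Q' := fun _ => True) (fun _ => Iff.rfl)
    (Primrec.primrecPred (by simpa using .const true)) fun p x => by simp [cfgEncoding]

theorem primrec₂_linearCFGEncoding : Primrec₂ linearCFGEncoding :=
  primrec₂_of_iff_exists_encode isLinear_iff primrecPred_linearRows fun p x => by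
    simp only [linearCFGEncoding, decide_eq_true_eq]
    exact exists_congr fun G => and_left_comm

end Decoding

/-! ### Encoding systems and learning in the limit -/

/-- One program evaluates `R` on pairs; fixing its first argument is computable in that argument
(the s-m-n theorem). -/
theorem isEncodingSystem_of_primrec {R : List Bool → List Bool → Bool} (hR : Primrec₂ R) :
    IsEncodingSystem R := by
  have h : Partrec fun c : List Bool × List Bool => Part.some (R c.1 c.2) := hR.to_comp
  obtain ⟨c, hc⟩ := Nat.Partrec.Code.exists_code.1 h
  refine ⟨fun p => c.curry (Encodable.encode p), ?_, fun p x => ?_⟩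
  · exact (Nat.Partrec.Code.primrec₂_curry.comp (.const c) .encode).to_comp
  · have := congrFun hc (Nat.pair (Encodable.encode p) (Encodable.encode x))
    rw [Nat.Partrec.Code.eval_curry, this]
    simp

/-- The learner that tries the first `|D|` strings and outputs the first one that is consistent
with the training set `D`. -/
def firstConsistent (R : List Bool → List Bool → Bool) (D : List (List Bool × Bool)) : List Bool :=
  (((List.range D.length).filter fun i => decide (∀ q ∈ D,
    R ((Encodable.decode (α := List Bool) i).getD []) q.1 = q.2)).head?.bind
      fun i => Encodable.decode (α := List Bool) i).getD []

open Primrec in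
theorem primrec_firstConsistent {R : List Bool → List Bool → Bool} (hR : Primrec₂ R) :
    Primrec (firstConsistent R) := by
  refine option_getD.comp (option_bind (list_head?.comp (primrec_filter
    (list_range.comp list_length) (primrecPred_forall_mem
      (p := fun (c : List (List Bool × Bool) × ℕ) q =>
        R ((Encodable.decode (α := List Bool) c.2).getD []) q.1 = q.2) fst ?_)))
    (Primrec.decode.comp snd)) (const [])
  exact Primrec.eq.comp (hR.comp (option_getD.comp (Primrec.decode.comp (snd.comp fst))
    (const [])) (fst.comp snd)) (snd.comp snd)

/-- The words `1^i` with `i ≤ N` already have `N + 1` different lengths. Hence the range searched by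
`firstConsistent` grows with `N` without bound. -/
theorem lt_length_trainingSet (N : ℕ) (f : List Bool → Bool) : N < (trainingSet N f).length := by
  have h : (List.range (N + 1)).Subperm ((stringsUpTo N).map List.length) := by
    refine List.nodup_range.subperm fun i hi => List.mem_map.2 ⟨List.replicate i true, ?_, by simp⟩
    rw [mem_stringsUpTo]
    simpa [Nat.lt_succ_iff] using hi
  simpa [trainingSet] using h.length_le

theorem forall_mem_trainingSet {N : ℕ} {f : List Bool → Bool} {P : List Bool × Bool → Prop} :
    (∀ q ∈ trainingSet N f, P q) ↔ ∀ x, x.length ≤ N → P (x, f x) := by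
  simp [trainingSet, mem_stringsUpTo]

/-- Identification by enumeration: each hypothesis before the first correct one is refuted by some
word. Once the training set contains all these finitely many words, the first consistent hypothesis
is the correct one. -/
theorem admitsLimit_of_primrec {R : List Bool → List Bool → Bool} (hR : Primrec₂ R)
    {F : Set (List Bool → Bool)} (hF : F ⊆ Set.range R) : AdmitsLimit R F := by
  refine ⟨firstConsistent R, (primrec_firstConsistent hR).to_comp, fun f hf => ?_⟩
  -- An index that decodes to no string stands for `[]`; the enumeration only has to reach every
  -- string.
  set S : ℕ → List Bool := fun i => (Encodable.decode (α := List Bool) i).getD [] with hS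
  obtain ⟨p, hp⟩ := hF hf
  have hex : ∃ i, R (S i) = f := ⟨Encodable.encode p, by simp [hS, hp]⟩
  classical
  have hmin : ∀ i, ∃ x, i < Nat.find hex → R (S i) x ≠ f x := by
    intro i
    by_cases hi : i < Nat.find hex
    · obtain ⟨x, hx⟩ := Function.ne_iff.1 (Nat.find_min hex hi)
      exact ⟨x, fun _ => hx⟩
    · exact ⟨[], fun h => absurd h hi⟩
  choose y hy using hmin
  set K := Nat.find hex with hK
  -- The summand `K` brings the correct index into the searched range; the sum exceeds the length of
  -- every refuting word.
  refine ⟨K + ∑ i ∈ Finset.range K, (y i).length, fun N hN => ?_⟩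
  have hlen := lt_length_trainingSet N f
  have hpred : ∀ i, (∀ q ∈ trainingSet N f, R (S i) q.1 = q.2) ↔
      ∀ x, x.length ≤ N → R (S i) x = f x := fun i => forall_mem_trainingSet
  have hK' : ∀ x, R (S K) x = f x := congrFun (Nat.find_spec hex)
  have hlt : ∀ i < K, ¬ ∀ x, x.length ≤ N → R (S i) x = f x := by
    intro i hi h
    refine hy i hi (h _ ?_)
    have : (y i).length ≤ ∑ i ∈ Finset.range K, (y i).length :=
      Finset.single_le_sum (f := fun i => (y i).length) (fun _ _ => Nat.zero_le _)
        (Finset.mem_range.2 hi)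
    omega
  have hfilter : ((List.range (trainingSet N f).length).filter fun i => decide
      (∀ q ∈ trainingSet N f, R (S i) q.1 = q.2)).head? = some K := by
    rw [List.head?_filter, List.find?_range_eq_some]
    simp only [hpred, decide_eq_true_eq, List.mem_range, Bool.not_eq_true', decide_eq_false_iff_not]
    exact ⟨fun x _ => hK' x, by omega, hlt⟩
  have hA : firstConsistent R (trainingSet N f) = S K := by
    rw [firstConsistent]
    change (Option.bind (((List.range (trainingSet N f).length).filter fun i => decide
      (∀ q ∈ trainingSet N f, R (S i) q.1 = q.2)).head?) _).getD [] = _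
    rw [hfilter]
    rfl
  rw [LearnsAt, hA]
  exact funext hK'

/-! ### Rational expressions over pairs of words and linear grammars -/

/-- Rational expressions over pairs of words, where the pair `(u, v)` acts on languages as
`L ↦ u L v`. -/
inductive PairExp
  | zero
  | atom (u v : List Bool)
  | add (a b : PairExp)
  | mul (a b : PairExp)
  | star (a : PairExp)

namespace PairExp

/-- The action of an expression on languages. -/
def act : PairExp → Set (List Bool) → Set (List Bool)
  | zero, _ => ∅
  | atom u v, L => {x | ∃ y ∈ L, x = u ++ (y ++ v)}
  | add a b, L => a.act L ∪ b.act L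
  | mul a b, L => a.act (b.act L)
  | star a, L => ⋃ n : ℕ, a.act^[n] L

/-- A bound for the size of a grammar. -/
def cost : PairExp → ℕ
  | zero => 1
  | atom u v => 3 + u.length + v.length
  | add a b => 5 + a.cost + b.cost
  | mul a b => 3 + a.cost + b.cost
  | star a => 5 + a.cost

theorem act_mono (e : PairExp) : Monotone e.act := by
  induction e with
  | zero => exact fun _ _ _ => le_rfl
  | atom u v => exact fun _ _ h _ ⟨y, hy, hx⟩ => ⟨y, h hy, hx⟩
  | add a b iha ihb => exact fun _ _ h => Set.union_subset_union (iha h) (ihb h)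
  | mul a b iha ihb => exact fun _ _ h => iha (ihb h)
  | star a iha => exact fun _ _ h => Set.iUnion_mono fun n => iha.iterate n h

/-- Every action preserves unions: a word in the result comes from a single word of `L`. This is
what commutes an expression with the union over `n` in a star. -/
theorem act_pointwise (e : PairExp) {L : Set (List Bool)} {x : List Bool} (hx : x ∈ e.act L) :
    ∃ y ∈ L, x ∈ e.act {y} := by
  induction e generalizing L x with
  | zero => exact hx.elim
  | atom u v =>
    obtain ⟨y, hy, rfl⟩ := hx
    exact ⟨y, hy, y, rfl, rfl⟩
  | add a b iha ihb =>
    rcases hx with hx | hx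
    · obtain ⟨y, hy, h⟩ := iha hx
      exact ⟨y, hy, .inl h⟩
    · obtain ⟨y, hy, h⟩ := ihb hx
      exact ⟨y, hy, .inr h⟩
  | mul a b iha ihb =>
    obtain ⟨z, hz, h⟩ := iha hx
    obtain ⟨y, hy, h'⟩ := ihb hz
    exact ⟨y, hy, act_mono a (Set.singleton_subset_iff.2 h') h⟩
  | star a iha =>
    obtain ⟨n, hn⟩ := Set.mem_iUnion.1 hx
    suffices ∃ y ∈ L, x ∈ a.act^[n] {y} from
      this.imp fun y hy => ⟨hy.1, Set.mem_iUnion.2 ⟨n, hy.2⟩⟩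
    clear hx
    induction n generalizing x with
    | zero => exact ⟨x, hn, rfl⟩
    | succ n ih =>
      rw [Function.iterate_succ_apply'] at hn
      obtain ⟨z, hz, h⟩ := iha hn
      obtain ⟨y, hy, h'⟩ := ih hz
      refine ⟨y, hy, ?_⟩
      rw [Function.iterate_succ_apply']
      exact act_mono a (Set.singleton_subset_iff.2 h') h

/-! ### The linear grammar whose nonterminals are stacks of pending expressions -/

/-- The right-hand sides for a stack of expressions. -/
def rhs : List PairExp → List (List (Symbol Bool (List PairExp)))
  | [] => [[]]
  | zero :: _ => []
  | atom u v :: K => [u.map .terminal ++ .nonterminal K :: v.map .terminal]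
  | add a b :: K => [[.nonterminal (a :: K)], [.nonterminal (b :: K)]]
  | mul a b :: K => [[.nonterminal (a :: b :: K)]]
  | star a :: K => [[.nonterminal K], [.nonterminal (a :: star a :: K)]]

/-- The stacks that come up while `e` is processed on top of `K`. -/
def reach : PairExp → List PairExp → List (List PairExp)
  | zero, K => [zero :: K]
  | atom u v, K => [atom u v :: K]
  | add a b, K => (add a b :: K) :: (a.reach K ++ b.reach K)
  | mul a b, K => (mul a b :: K) :: (a.reach (b :: K) ++ b.reach K)
  | star a, K => (star a :: K) :: a.reach (star a :: K)

theorem self_mem_reach (e : PairExp) (K : List PairExp) : e :: K ∈ e.reach K := by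
  cases e <;> simp [reach]

/-- Processing `e` creates only stacks of `e.reach K` until it exposes `K` itself. With `K = []`
this makes the set of nonterminals closed under the rules. -/
theorem mem_reach_of_rhs (e : PairExp) (K : List PairExp) {K₁ K₂ : List PairExp}
    (h₁ : K₁ ∈ e.reach K) {α : List (Symbol Bool (List PairExp))} (hα : α ∈ rhs K₁)
    (h₂ : .nonterminal K₂ ∈ α) : K₂ ∈ e.reach K ∨ K₂ = K := by
  induction e generalizing K with
  | zero =>
    cases List.mem_singleton.1 h₁
    simp [rhs] at hα
  | atom u v =>
    cases List.mem_singleton.1 h₁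
    cases List.mem_singleton.1 hα
    right
    simpa using h₂
  | add a b iha ihb =>
    rw [reach, List.mem_cons, List.mem_append] at h₁ ⊢
    rcases h₁ with rfl | h₁ | h₁
    · simp only [rhs, List.mem_cons, List.not_mem_nil, or_false] at hα
      have ha := self_mem_reach a K
      have hb := self_mem_reach b K
      rcases hα with rfl | rfl <;> simp at h₂ <;> simp [h₂, ha, hb]
    · rcases iha K h₁ with h | h <;> simp [h]
    · rcases ihb K h₁ with h | h <;> simp [h]
  | mul a b iha ihb =>
    rw [reach, List.mem_cons, List.mem_append] at h₁ ⊢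
    rcases h₁ with rfl | h₁ | h₁
    · simp only [rhs, List.mem_cons, List.not_mem_nil, or_false] at hα
      have ha := self_mem_reach a (b :: K)
      subst hα
      simp at h₂
      simp [h₂, ha]
    · rcases iha (b :: K) h₁ with h | h
      · simp [h]
      · simp [h, self_mem_reach b K]
    · rcases ihb K h₁ with h | h <;> simp [h]
  | star a iha =>
    rw [reach, List.mem_cons] at h₁ ⊢
    rcases h₁ with rfl | h₁
    · simp only [rhs, List.mem_cons, List.not_mem_nil, or_false] at hα
      have ha := self_mem_reach a (star a :: K)
      rcases hα with rfl | rfl <;> simp at h₂ <;> simp [h₂, ha]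
    · rcases iha (star a :: K) h₁ with h | h <;> simp [h]

/-- The contribution of a stack to the size of the grammar. -/
def stackCost (K : List PairExp) : ℕ :=
  1 + ((rhs K).map fun α => 1 + α.length).sum

/-- Each subexpression contributes one stack, counted with multiplicity, so the contributions add up
along the expression and `cost` is exact here. Identifying equal stacks can only reduce the size. -/
theorem sum_stackCost (e : PairExp) (K : List PairExp) :
    ((e.reach K).map stackCost).sum = e.cost := by
  induction e generalizing K with
  | zero => simp [reach, stackCost, rhs, cost]
  | atom u v => simp [reach, stackCost, rhs, cost]; omega
  | add a b iha ihb => simp [reach, stackCost, rhs, cost, iha, ihb]; omega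
  | mul a b iha ihb => simp [reach, stackCost, rhs, cost, iha, ihb]; omega
  | star a iha => simp [reach, stackCost, rhs, cost, iha]

/-- The language of a stack. -/
def stackLang (K : List PairExp) : Set (List Bool) :=
  K.foldr act {[]}

/-- The words of a sentential form whose nonterminals are stacks. -/
def formLang : List (Symbol Bool (List PairExp)) → Set (List Bool)
  | [] => {[]}
  | .terminal b :: α => {x | ∃ v ∈ formLang α, x = b :: v}
  | .nonterminal K :: α => {x | ∃ u ∈ stackLang K, ∃ v ∈ formLang α, x = u ++ v}

theorem mem_formLang_append_terminals {u : List Bool} {α : List (Symbol Bool (List PairExp))}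
    {x : List Bool} :
    x ∈ formLang (u.map .terminal ++ α) ↔ ∃ v ∈ formLang α, x = u ++ v := by
  induction u generalizing x with
  | nil => simp
  | cons b u ih =>
    simp only [List.map_cons, List.cons_append, formLang, Set.mem_ofPred_eq, ih]
    constructor
    · rintro ⟨_, ⟨v, hv, rfl⟩, rfl⟩
      exact ⟨v, hv, rfl⟩
    · rintro ⟨v, hv, rfl⟩
      exact ⟨_, ⟨v, hv, rfl⟩, rfl⟩

theorem mem_formLang_terminals {u x : List Bool} :
    x ∈ formLang (u.map .terminal) ↔ x = u := by
  rw [← List.append_nil (u.map _), mem_formLang_append_terminals]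
  simp [formLang]

theorem mem_formLang_nonterminal {K : List PairExp} {x : List Bool} :
    x ∈ formLang [.nonterminal K] ↔ x ∈ stackLang K := by
  simp [formLang]

/-- Soundness of the rules: the intended languages are closed under every rule, so nothing outside
them can be derived. -/
theorem stackLang_of_rhs {K : List PairExp} {α : List (Symbol Bool (List PairExp))}
    (hα : α ∈ rhs K) : formLang α ⊆ stackLang K := by
  intro x hx
  match K, hα with
  | [], hα =>
    cases List.mem_singleton.1 hα
    exact hx
  | zero :: K, hα => simp [rhs] at hα
  | atom u v :: K, hα =>
    cases List.mem_singleton.1 hα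
    obtain ⟨y, ⟨z, hz, t, ht, rfl⟩, rfl⟩ := mem_formLang_append_terminals.1 hx
    exact ⟨z, hz, by rw [mem_formLang_terminals.1 ht]⟩
  | add a b :: K, hα =>
    simp only [rhs, List.mem_cons, List.not_mem_nil, or_false] at hα
    rcases hα with rfl | rfl
    · exact .inl (mem_formLang_nonterminal.1 hx)
    · exact .inr (mem_formLang_nonterminal.1 hx)
  | mul a b :: K, hα =>
    cases List.mem_singleton.1 hα
    exact mem_formLang_nonterminal.1 hx
  | star a :: K, hα =>
    simp only [rhs, List.mem_cons, List.not_mem_nil, or_false] at hα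
    rcases hα with rfl | rfl
    · exact Set.mem_iUnion.2 ⟨0, mem_formLang_nonterminal.1 hx⟩
    · have hx := mem_formLang_nonterminal.1 hx
      -- A single word of the union lies in some power `n`, and applying `a` once more puts the
      -- result in power `n + 1`.
      obtain ⟨y, hy, h⟩ := act_pointwise a (L := ⋃ n : ℕ, a.act^[n] (stackLang K))
        hx
      obtain ⟨n, hn⟩ := Set.mem_iUnion.1 hy
      refine Set.mem_iUnion.2 ⟨n + 1, ?_⟩
      rw [Function.iterate_succ_apply']
      exact act_mono a (Set.singleton_subset_iff.2 hn) h

/-- The rules whose left-hand side is one of the given stacks. -/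
def StackRule (Γ : List (List PairExp)) (X : Symbol Bool (List PairExp))
    (α : List (Symbol Bool (List PairExp))) : Prop :=
  ∃ K ∈ Γ, X = .nonterminal K ∧ α ∈ rhs K

theorem mem_formLang_of_yields {Γ : List (List PairExp)} {α : List (Symbol Bool (List PairExp))}
    {x : List Bool} (h : Yields (StackRule Γ) .terminal α x) : x ∈ formLang α := by
  induction h with
  | nil => rfl
  | terminal b _ ih => exact ⟨_, ih, rfl⟩
  | rule hX _ _ ih1 ih2 =>
    obtain ⟨K, -, rfl, h⟩ := hX
    exact ⟨_, stackLang_of_rhs h ih1, _, ih2, rfl⟩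

/-- The words derived from a stack. -/
def stackYields (Γ : List (List PairExp)) (K : List PairExp) : Set (List Bool) :=
  {x | Yields (StackRule Γ) .terminal [.nonterminal K] x}

theorem stackYields_of_rhs {Γ : List (List PairExp)} {K : List PairExp} (hK : K ∈ Γ)
    {α : List (Symbol Bool (List PairExp))} (hα : α ∈ rhs K) {x : List Bool}
    (hx : Yields (StackRule Γ) .terminal α x) : x ∈ stackYields Γ K := by
  have := Yields.rule (P := StackRule Γ) ⟨K, hK, rfl, hα⟩ hx .nil
  rwa [List.append_nil] at this

/-- Completeness, with the words derived from `K` as the language acted upon: keeping `K` arbitrary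
lets the induction pass to `b :: K` for a product and to `star a :: K` for a star. -/
theorem act_stackYields {Γ : List (List PairExp)} (e : PairExp) {K : List PairExp}
    (hK : e.reach K ⊆ Γ) : e.act (stackYields Γ K) ⊆ stackYields Γ (e :: K) := by
  have hself := hK (self_mem_reach e K)
  induction e generalizing K with
  | zero => exact fun _ h => h.elim
  | atom u v =>
    rintro _ ⟨y, hy, rfl⟩
    have hy : Yields (StackRule Γ) Symbol.terminal [.nonterminal K] y := hy
    exact stackYields_of_rhs hself (List.mem_singleton.2 rfl)
      ((Yields.map_terminal u).append (hy.append (Yields.map_terminal v)))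
  | add a b iha ihb =>
    simp only [reach, List.cons_subset, List.append_subset] at hK
    rintro x (hx | hx)
    · exact stackYields_of_rhs hself (α := [.nonterminal (a :: K)]) (by simp [rhs])
        (iha hK.2.1 (hK.2.1 (self_mem_reach _ _)) hx)
    · exact stackYields_of_rhs hself (α := [.nonterminal (b :: K)]) (by simp [rhs])
        (ihb hK.2.2 (hK.2.2 (self_mem_reach _ _)) hx)
  | mul a b iha ihb =>
    simp only [reach, List.cons_subset, List.append_subset] at hK
    intro x hx
    exact stackYields_of_rhs hself (List.mem_singleton.2 rfl)
      (iha hK.2.1 (hK.2.1 (self_mem_reach _ _))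
        (act_mono a (ihb hK.2.2 (hK.2.2 (self_mem_reach _ _))) hx))
  | star a iha =>
    simp only [reach, List.cons_subset] at hK
    refine Set.iUnion_subset fun n => ?_
    induction n with
    | zero =>
      exact fun x hx => stackYields_of_rhs hself (α := [.nonterminal K]) (by simp [rhs]) hx
    | succ n ih =>
      rw [Function.iterate_succ_apply']
      intro x hx
      exact stackYields_of_rhs hself (α := [.nonterminal (a :: star a :: K)]) (by simp [rhs])
        (iha hK.2 (hK.2 (self_mem_reach _ _)) (act_mono a ih hx))

/-- The words that an expression denotes. -/
def lang (e : PairExp) : Set (List Bool) :=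
  e.act {[]}

open Classical in
/-- The stacks that serve as nonterminals. -/
noncomputable def states (e : PairExp) : List (List PairExp) :=
  ([] :: e.reach []).dedup

theorem mem_states_of_rhs {e : PairExp} {K : List PairExp} (hK : K ∈ e.states)
    {α : List (Symbol Bool (List PairExp))} (hα : α ∈ rhs K) {K' : List PairExp}
    (hK' : .nonterminal K' ∈ α) : K' ∈ e.states := by
  simp only [states, List.mem_dedup, List.mem_cons] at hK ⊢
  rcases hK with rfl | hK
  · cases List.mem_singleton.1 hα
    simp at hK'
  · exact (mem_reach_of_rhs e [] hK hα hK').symm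

theorem yields_states_iff {e : PairExp} {x : List Bool} :
    Yields (StackRule e.states) .terminal [.nonterminal [e]] x ↔ x ∈ e.lang := by
  constructor
  · intro h
    exact mem_formLang_nonterminal.1 (mem_formLang_of_yields h)
  · intro h
    refine act_stackYields e (K := []) (Γ := e.states) ?_ (act_mono e ?_ h)
    · exact fun K hK => by simp [states, hK]
    · rintro _ rfl
      exact stackYields_of_rhs (by simp [states]) (List.mem_singleton.2 rfl) .nil

theorem mem_states_self (e : PairExp) : [e] ∈ e.states := by
  simp [states, self_mem_reach]

/-- Renaming of nonterminals. -/
def mapSymbol {M N : Type} (f : M → N) : Symbol Bool M → Symbol Bool N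
  | .terminal b => .terminal b
  | .nonterminal X => .nonterminal (f X)

open Classical in
/-- The number of a stack. -/
noncomputable def stateIndex (e : PairExp) (K : List PairExp) : Fin e.states.length :=
  if h : K ∈ e.states then ⟨e.states.idxOf K, List.idxOf_lt_length_iff.2 h⟩
  else ⟨0, List.length_pos_of_mem e.mem_states_self⟩

theorem get_stateIndex {e : PairExp} {K : List PairExp} (h : K ∈ e.states) :
    e.states.get (e.stateIndex K) = K := by
  simp [stateIndex, h]

open Classical in
/-- The rules of the linear grammar of an expression. -/
noncomputable def ruleList (e : PairExp) : List (ContextFreeRule Bool (Fin e.states.length)) :=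
  ((List.finRange e.states.length).flatMap fun i =>
    (rhs (e.states.get i)).map fun α => ⟨i, α.map (mapSymbol e.stateIndex)⟩).dedup

/-- The linear grammar of an expression. -/
noncomputable def toCFG (e : PairExp) : CFG where
  numNT := e.states.length
  start := e.stateIndex [e]
  rules := e.ruleList
  nodup := List.nodup_dedup _

theorem mem_ruleList {e : PairExp} {r : ContextFreeRule Bool (Fin e.states.length)} :
    r ∈ e.ruleList ↔
      ∃ α ∈ rhs (e.states.get r.input), r.output = α.map (mapSymbol e.stateIndex) := by
  obtain ⟨i, β⟩ := r
  simp only [ruleList, List.mem_dedup, List.mem_flatMap, List.mem_finRange, true_and, List.mem_map,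
    ContextFreeRule.mk.injEq]
  constructor
  · rintro ⟨_, α, hα, rfl, rfl⟩
    exact ⟨α, hα, rfl⟩
  · rintro ⟨α, hα, rfl⟩
    exact ⟨i, α, hα, rfl, rfl⟩

theorem isLinear_toCFG (e : PairExp) : e.toCFG.IsLinear := by
  change ∀ r ∈ e.ruleList, r.output.countP CFG.isNonterminal ≤ 1
  intro r hr
  obtain ⟨α, hα, h⟩ := mem_ruleList.1 hr
  have h1 : (CFG.isNonterminal ∘ mapSymbol (e.stateIndex)) = CFG.isNonterminal := by
    funext X
    cases X <;> rfl
  have h2 : ∀ w : List Bool, (w.map (Symbol.terminal (N := List PairExp))).countP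
      CFG.isNonterminal = 0 := by
    intro w
    rw [List.countP_map, List.countP_eq_zero]
    simp [CFG.isNonterminal]
  rw [h, List.countP_map, h1]
  generalize e.states.get r.input = K at hα
  match K, hα with
  | [], hα =>
    cases List.mem_singleton.1 hα
    simp
  | zero :: K, hα => simp [rhs] at hα
  | atom u v :: K, hα =>
    cases List.mem_singleton.1 hα
    simp [h2, List.countP_cons, CFG.isNonterminal]
  | add a b :: K, hα =>
    simp only [rhs, List.mem_cons, List.not_mem_nil, or_false] at hα
    rcases hα with rfl | rfl <;> simp [CFG.isNonterminal]
  | mul a b :: K, hα =>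
    cases List.mem_singleton.1 hα
    simp [CFG.isNonterminal]
  | star a :: K, hα =>
    simp only [rhs, List.mem_cons, List.not_mem_nil, or_false] at hα
    rcases hα with rfl | rfl <;> simp [CFG.isNonterminal]

/-- The additional `4` consists of `2` for the terminals and `2` for the empty stack: one
nonterminal and its rule with empty right-hand side, of length one. -/
theorem size_toCFG_le (e : PairExp) : e.toCFG.size ≤ e.cost + 4 := by
  classical
  have h1 : (e.ruleList.map fun r => 1 + r.output.length).sum ≤
      (e.states.map fun K => ((rhs K).map fun α => 1 + α.length).sum).sum := by
    refine (((List.dedup_sublist _).map _).sum_le_sum fun _ _ => Nat.zero_le _).trans ?_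
    rw [List.map_flatMap, List.flatMap, List.sum_flatten, List.map_map]
    conv_rhs => rw [← List.map_get_finRange e.states, List.map_map]
    simp [Function.comp_def]
  have h2 : (e.states.map stackCost).sum ≤ e.cost + 2 := by
    refine (((List.dedup_sublist _).map _).sum_le_sum fun _ _ => Nat.zero_le _).trans ?_
    rw [List.map_cons, List.sum_cons, sum_stackCost]
    simp [stackCost, rhs]
    omega
  have h3 : (e.states.map stackCost).sum = e.states.length +
      (e.states.map fun K => ((rhs K).map fun α => 1 + α.length).sum).sum := by
    change (e.states.map fun K => 1 + _).sum = _
    rw [List.sum_map_add]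
    simp
  have h4 : e.toCFG.size = e.states.length + 2 +
    (e.ruleList.map fun r => 1 + r.output.length).sum := rfl
  omega

/-- Numbering the stacks is an injective renaming, so `Yields.map_iff` transports the statement from
the grammar on stacks; closure of the state set ensures that renaming back recovers each right-hand
side. -/
theorem mem_language_toCFG (e : PairExp) (x : List Bool) :
    x ∈ e.toCFG.toGrammar.language ↔ x ∈ e.lang := by
  classical
  rw [mem_language_iff_yields, ← yields_states_iff]
  have hinj : Function.Injective
      (mapSymbol e.states.get : Symbol Bool (Fin e.states.length) → _) := by
    have hst : Function.Injective e.states.get :=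
      List.nodup_iff_injective_get.1 (List.nodup_dedup _)
    rintro (a | a) (b | b) h <;> simp only [mapSymbol, reduceCtorEq, Symbol.terminal.injEq,
      Symbol.nonterminal.injEq] at h
    · rw [h]
    · rw [hst h]
  have hmap : ∀ K ∈ e.states, ∀ α ∈ rhs K,
      (α.map (mapSymbol e.stateIndex)).map (mapSymbol e.states.get) = α := by
    intro K hK α hα
    rw [List.map_map]
    conv_rhs => rw [← List.map_id α]
    refine List.map_congr_left fun X hX => ?_
    cases X with
    | terminal b => rfl
    | nonterminal K' =>
      simp only [Function.comp, mapSymbol, get_stateIndex (mem_states_of_rhs hK hα hX), id]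
  have := Yields.map_iff (P := IsRule e.toCFG.toGrammar) (τ := Symbol.terminal) hinj
    (P' := StackRule e.states) (α := [.nonterminal (e.stateIndex [e])]) (w := x) (by
      intro X α
      constructor
      · rintro ⟨K, hK, rfl, hα⟩
        refine ⟨.nonterminal (e.stateIndex K), _, ⟨⟨e.stateIndex K, _⟩,
          (mem_toGrammar_rules _).2 (mem_ruleList.2 ⟨α, ?_, rfl⟩), rfl, rfl⟩, ?_, hmap K hK α hα⟩
        · rwa [get_stateIndex hK]
        · simp only [mapSymbol, get_stateIndex hK]
      · rintro ⟨_, _, ⟨r, hr, rfl, rfl⟩, rfl, rfl⟩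
        obtain ⟨α, hα, h⟩ := mem_ruleList.1 ((mem_toGrammar_rules r).1 hr)
        have hK : e.states.get r.input ∈ e.states := List.get_mem _ _
        refine ⟨_, hK, rfl, ?_⟩
        rw [h]
        exact (hmap _ hK α hα).symm ▸ hα)
  have h : (mapSymbol e.states.get (.nonterminal (e.stateIndex [e])) : Symbol Bool _) =
      .nonterminal [e] := congrArg Symbol.nonterminal (get_stateIndex e.mem_states_self)
  change Yields _ _ [mapSymbol e.states.get (.nonterminal (e.stateIndex [e]))] x ↔ _ at this
  rw [h] at this
  exact this.symm

/-! ### Expressions for words that consist of unary blocks -/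

/-- The word `1^n`. -/
abbrev ones (n : ℕ) : List Bool :=
  List.replicate n true

/-- The blocks `1^n 0` for the numbers `n` of a list. -/
def blocks (ns : List ℕ) : List Bool :=
  ns.flatMap fun n => ones n ++ [false]

/-- The word with the blocks `ns`, followed by `1^m`. -/
def blockWord (ns : List ℕ) (m : ℕ) : List Bool :=
  blocks ns ++ ones m

theorem blockWord_nil (m : ℕ) : blockWord [] m = ones m := rfl

theorem blockWord_cons (n : ℕ) (ns : List ℕ) (m : ℕ) :
    blockWord (n :: ns) m = ones n ++ false :: blockWord ns m := by
  simp [blockWord, blocks]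

theorem blockWord_append (ns ns' : List ℕ) (m : ℕ) :
    blockWord (ns ++ ns') m = blocks ns ++ blockWord ns' m := by
  simp [blockWord, blocks]

theorem exists_blockWord (x : List Bool) : ∃ ns m, x = blockWord ns m := by
  induction x with
  | nil => exact ⟨[], 0, rfl⟩
  | cons b x ih =>
    obtain ⟨ns, m, rfl⟩ := ih
    cases b with
    | false => exact ⟨0 :: ns, m, (blockWord_cons 0 ns m).symm⟩
    | true =>
      cases ns with
      | nil => exact ⟨[], m + 1, rfl⟩
      | cons n ns => exact ⟨(n + 1) :: ns, m, by simp [blockWord_cons, List.replicate_succ]⟩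

theorem ones_append_false_inj {a b : ℕ} {x y : List Bool}
    (h : ones a ++ false :: x = ones b ++ false :: y) : a = b ∧ x = y := by
  induction a generalizing b with
  | zero => cases b <;> simp_all [List.replicate_succ]
  | succ a ih =>
    cases b with
    | zero => simp [List.replicate_succ] at h
    | succ b =>
      simp only [List.replicate_succ, List.cons_append, List.cons.injEq, true_and] at h
      simpa using ih h

theorem blockWord_eq_ones_append {a : ℕ} {y : List Bool} {ns : List ℕ} {m : ℕ} :
    blockWord ns m = ones a ++ false :: y ↔ ∃ ns', ns = a :: ns' ∧ y = blockWord ns' m := by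
  constructor
  · intro h
    cases ns with
    | nil =>
      have : false ∈ ones m := by
        rw [← blockWord_nil, h]
        simp
      simp at this
    | cons n ns =>
      rw [blockWord_cons] at h
      obtain ⟨rfl, rfl⟩ := ones_append_false_inj h
      exact ⟨ns, rfl, rfl⟩
  · rintro ⟨ns', rfl, rfl⟩
    exact blockWord_cons _ _ _

theorem blockWord_eq_blocks_append {l : List ℕ} {y : List Bool} {ns : List ℕ} {m : ℕ} :
    blockWord ns m = blocks l ++ y ↔ ∃ ns', ns = l ++ ns' ∧ y = blockWord ns' m := by
  induction l generalizing ns with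
  | nil => simp [blocks, eq_comm]
  | cons a l ih =>
    have : blocks (a :: l) ++ y = ones a ++ false :: (blocks l ++ y) := by simp [blocks]
    rw [this, blockWord_eq_ones_append]
    constructor
    · rintro ⟨ns', rfl, h⟩
      obtain ⟨ns'', rfl, rfl⟩ := ih.1 h.symm
      exact ⟨ns'', rfl, rfl⟩
    · rintro ⟨ns', rfl, rfl⟩
      exact ⟨_, rfl, (ih.2 ⟨ns', rfl, rfl⟩).symm⟩

theorem blockWord_inj {ns ns' : List ℕ} {m m' : ℕ} (h : blockWord ns m = blockWord ns' m') :
    ns = ns' ∧ m = m' := by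
  rw [blockWord, eq_comm, blockWord_eq_blocks_append] at h
  obtain ⟨l, rfl, h⟩ := h
  cases l with
  | nil =>
    rw [blockWord_nil] at h
    have := congrArg List.length h
    simp at this
    simp [this]
  | cons a l =>
    rw [blockWord_cons] at h
    have : false ∈ ones m := by rw [h]; simp
    simp at this

/-- A sum of expressions. -/
def sum (l : List PairExp) : PairExp :=
  l.foldr add zero

theorem mem_act_sum {l : List PairExp} {A : Set (List Bool)} {x : List Bool} :
    x ∈ (sum l).act A ↔ ∃ e ∈ l, x ∈ e.act A := by
  induction l with
  | nil => exact ⟨fun h => h.elim, by simp⟩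
  | cons a l ih =>
    simp only [List.mem_cons, exists_eq_or_imp, ← ih]
    rfl

theorem mem_act_sum_map {ι : Type*} {l : List ι} {f : ι → PairExp} {A : Set (List Bool)}
    {x : List Bool} : x ∈ (sum (l.map f)).act A ↔ ∃ i ∈ l, x ∈ (f i).act A := by
  simp [mem_act_sum]

/-- The pair `(u, ε)`. -/
abbrev left (u : List Bool) : PairExp :=
  atom u []

theorem mem_act_left {u x : List Bool} {A : Set (List Bool)} :
    x ∈ (left u).act A ↔ ∃ y ∈ A, x = u ++ y := by
  simp [act]

theorem mem_act_mul {a b : PairExp} {A : Set (List Bool)} {x : List Bool} :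
    x ∈ (mul a b).act A ↔ x ∈ a.act (b.act A) := Iff.rfl

theorem mem_act_add {a b : PairExp} {A : Set (List Bool)} {x : List Bool} :
    x ∈ (add a b).act A ↔ x ∈ a.act A ∨ x ∈ b.act A := Iff.rfl

theorem mem_act_star {a : PairExp} {A : Set (List Bool)} {x : List Bool} :
    x ∈ (star a).act A ↔ x ∈ A ∨ x ∈ a.act ((star a).act A) := by
  constructor
  · intro h
    obtain ⟨n, hn⟩ := Set.mem_iUnion.1 h
    cases n with
    | zero => exact .inl hn
    | succ n =>
      rw [Function.iterate_succ_apply'] at hn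
      exact .inr (act_mono a (Set.subset_iUnion (fun n => a.act^[n] A) n) hn)
  · rintro (h | h)
    · exact Set.mem_iUnion.2 ⟨0, h⟩
    · obtain ⟨y, hy, h⟩ := act_pointwise a h
      obtain ⟨n, hn⟩ := Set.mem_iUnion.1 hy
      refine Set.mem_iUnion.2 ⟨n + 1, ?_⟩
      rw [Function.iterate_succ_apply']
      exact act_mono a (Set.singleton_subset_iff.2 hn) h

/-- All words. -/
def anyWord : PairExp :=
  star (add (left [false]) (left [true]))

theorem mem_lang_anyWord (x : List Bool) : x ∈ anyWord.lang := by
  induction x with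
  | nil => exact mem_act_star.2 (.inl rfl)
  | cons b x ih =>
    refine mem_act_star.2 (.inr ?_)
    cases b
    · exact .inl (mem_act_left.2 ⟨x, ih, rfl⟩)
    · exact .inr (mem_act_left.2 ⟨x, ih, rfl⟩)

/-- The words that do not begin with `w`. -/
def notPrefix : List Bool → PairExp
  | [] => zero
  | b :: w => add (left []) (add (mul (left [!b]) anyWord) (mul (left [b]) (notPrefix w)))

theorem mem_lang_notPrefix {w x : List Bool} : x ∈ (notPrefix w).lang ↔ ¬ w <+: x := by
  induction w generalizing x with
  | nil => exact ⟨fun h => h.elim, fun h => absurd (List.nil_prefix) h⟩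
  | cons b w ih =>
    change x ∈ (left []).act {[]} ∨ x ∈ (left [!b]).act anyWord.lang ∨
      x ∈ (left [b]).act (notPrefix w).lang ↔ _
    rw [mem_act_left, mem_act_left, mem_act_left]
    cases x with
    | nil => simp
    | cons c x =>
      rw [List.cons_prefix_cons]
      simp only [mem_lang_anyWord, ih]
      cases b <;> cases c <;> simp

/-- Each letter costs exactly `45`, of which `18` is the copy of `anyWord` after a wrong letter. -/
theorem cost_notPrefix_le (w : List Bool) : (notPrefix w).cost ≤ 1 + 45 * w.length := by
  induction w with
  | nil => simp [notPrefix, cost]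
  | cons b w ih =>
    simp only [notPrefix, cost, anyWord, left, List.length_cons, List.length_nil]
    omega

/-! ### Expressions that consume blocks from the left -/

/-- The expression consumes lists of blocks that belong to `S`. -/
def Consumes (e : PairExp) (S : Set (List ℕ)) : Prop :=
  ∀ (A : Set (List Bool)) (ns : List ℕ) (m : ℕ),
    blockWord ns m ∈ e.act A ↔ ∃ l ∈ S, ∃ ns', ns = l ++ ns' ∧ blockWord ns' m ∈ A

theorem Consumes.congr {e : PairExp} {S S' : Set (List ℕ)} (h : Consumes e S)
    (hS : ∀ l, l ∈ S ↔ l ∈ S') : Consumes e S' :=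
  Set.ext hS ▸ h

theorem Consumes.mul {a b : PairExp} {S S' : Set (List ℕ)} (ha : Consumes a S)
    (hb : Consumes b S') : Consumes (mul a b) {l | ∃ u ∈ S, ∃ v ∈ S', l = u ++ v} := by
  intro A ns m
  rw [mem_act_mul, ha]
  simp only [hb A]
  constructor
  · rintro ⟨u, hu, _, rfl, v, hv, ns', rfl, h⟩
    exact ⟨u ++ v, ⟨u, hu, v, hv, rfl⟩, ns', by simp, h⟩
  · rintro ⟨_, ⟨u, hu, v, hv, rfl⟩, ns', rfl, h⟩
    exact ⟨u, hu, v ++ ns', by simp, v, hv, ns', rfl, h⟩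

theorem Consumes.sum {ι : Type*} {l : List ι} {f : ι → PairExp} {S : ι → Set (List ℕ)}
    (h : ∀ i, Consumes (f i) (S i)) : Consumes (sum (l.map f)) {u | ∃ i ∈ l, u ∈ S i} := by
  intro A ns m
  simp only [mem_act_sum_map]
  constructor
  · rintro ⟨i, hi, h'⟩
    obtain ⟨u, hu, h'⟩ := (h i A ns m).1 h'
    exact ⟨u, ⟨i, hi, hu⟩, h'⟩
  · rintro ⟨u, ⟨i, hi, hu⟩, h'⟩
    exact ⟨i, hi, (h i A ns m).2 ⟨u, hu, h'⟩⟩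

theorem Consumes.star {a : PairExp} {S : Set (List ℕ)} (ha : Consumes a S) :
    Consumes (star a) {l | ∃ ls : List (List ℕ), (∀ u ∈ ls, u ∈ S) ∧ l = ls.flatten} := by
  intro A ns m
  constructor
  · intro h
    obtain ⟨n, hn⟩ := Set.mem_iUnion.1 h
    clear h
    induction n generalizing ns with
    | zero => exact ⟨[], ⟨[], by simp, rfl⟩, ns, rfl, hn⟩
    | succ n ih =>
      rw [Function.iterate_succ_apply', ha] at hn
      obtain ⟨u, hu, ns', rfl, h⟩ := hn
      obtain ⟨_, ⟨ls, hls, rfl⟩, ns'', rfl, h'⟩ := ih ns' h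
      exact ⟨u ++ ls.flatten, ⟨u :: ls, by simpa using ⟨hu, hls⟩, by simp⟩, ns'', by simp, h'⟩
  · rintro ⟨_, ⟨ls, hls, rfl⟩, ns', rfl, h⟩
    induction ls with
    | nil => exact mem_act_star.2 (.inl h)
    | cons u ls ih =>
      refine mem_act_star.2 (.inr ((ha _ _ _).2 ⟨u, hls u (by simp), ls.flatten ++ ns', by simp,
        ih fun v hv => hls v (by simp [hv])⟩))

/-- One block that contains the number `k`. -/
def block (k : ℕ) : PairExp :=
  left (ones k ++ [false])

theorem consumes_block (k : ℕ) : Consumes (block k) {[k]} := by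
  intro A ns m
  rw [block, mem_act_left]
  simp only [List.append_assoc, List.cons_append, List.nil_append, blockWord_eq_ones_append,
    Set.mem_singleton_iff, exists_eq_left]
  constructor
  · rintro ⟨_, hy, ns', rfl, rfl⟩
    exact ⟨ns', rfl, hy⟩
  · rintro ⟨ns', rfl, h⟩
    exact ⟨_, h, ns', rfl, rfl⟩

theorem mem_act_star_ones {p : ℕ} {A : Set (List Bool)} {x : List Bool} :
    x ∈ (star (left (ones p))).act A ↔ ∃ n, ∃ y ∈ A, x = ones (n * p) ++ y := by
  constructor
  · intro h
    obtain ⟨n, hn⟩ := Set.mem_iUnion.1 h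
    refine ⟨n, ?_⟩
    clear h
    induction n generalizing x with
    | zero => exact ⟨x, hn, by simp⟩
    | succ n ih =>
      rw [Function.iterate_succ_apply', mem_act_left] at hn
      obtain ⟨z, hz, rfl⟩ := hn
      obtain ⟨y, hy, rfl⟩ := ih hz
      exact ⟨y, hy, by rw [← List.append_assoc, ← List.replicate_add]; congr 2; ring⟩
  · rintro ⟨n, y, hy, rfl⟩
    induction n with
    | zero => exact mem_act_star.2 (.inl (by simpa using hy))
    | succ n ih =>
      refine mem_act_star.2 (.inr (mem_act_left.2 ⟨_, ih, ?_⟩))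
      rw [← List.append_assoc, ← List.replicate_add]
      congr 2
      ring

/-- One block whose number is congruent to `e` modulo `p` and at least `e`. -/
def blockMod (p e : ℕ) : PairExp :=
  mul (star (left (ones p))) (block e)

theorem consumes_blockMod (p e : ℕ) : Consumes (blockMod p e) {l | ∃ n, l = [n * p + e]} := by
  intro A ns m
  rw [blockMod, mem_act_mul, mem_act_star_ones]
  have : ∀ y, y ∈ (block e).act A ↔ ∃ z ∈ A, y = ones e ++ false :: z := by
    intro y
    rw [block, mem_act_left]
    simp
  simp only [this]
  constructor
  · rintro ⟨n, _, ⟨z, hz, rfl⟩, h⟩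
    rw [← List.append_assoc, ← List.replicate_add, blockWord_eq_ones_append] at h
    obtain ⟨ns', rfl, rfl⟩ := h
    exact ⟨_, ⟨n, rfl⟩, ns', rfl, hz⟩
  · rintro ⟨_, ⟨n, rfl⟩, ns', rfl, h⟩
    refine ⟨n, _, ⟨_, h, rfl⟩, ?_⟩
    rw [← List.append_assoc, ← List.replicate_add]
    exact blockWord_cons _ _ _

/-- One block. -/
def anyBlock : PairExp :=
  blockMod 1 0

theorem consumes_anyBlock : Consumes anyBlock {l | l.length = 1} :=
  (consumes_blockMod 1 0).congr fun l => by
    simp [List.length_eq_one_iff]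

/-- `j` blocks. -/
def anyBlocks : ℕ → PairExp
  | 0 => left []
  | j + 1 => mul anyBlock (anyBlocks j)

theorem consumes_anyBlocks (j : ℕ) : Consumes (anyBlocks j) {l | l.length = j} := by
  induction j with
  | zero =>
    intro A ns m
    rw [anyBlocks, mem_act_left]
    simp
  | succ j ih =>
    refine (consumes_anyBlock.mul ih).congr fun l => ?_
    constructor
    · rintro ⟨u, hu, v, hv, rfl⟩
      have hu : u.length = 1 := hu
      have hv : v.length = j := hv
      change (u ++ v).length = j + 1
      simp [hu, hv, add_comm]
    · intro hl
      have hl : l.length = j + 1 := hl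
      exact ⟨l.take 1, by change (l.take 1).length = 1; simp [hl], l.drop 1,
        by change (l.drop 1).length = j; simp [hl],
        (List.take_append_drop 1 l).symm⟩

theorem mem_lang_mul_anyWord {e : PairExp} {S : Set (List ℕ)} (he : Consumes e S) {ns : List ℕ}
    {m : ℕ} : blockWord ns m ∈ (mul e anyWord).lang ↔ ∃ l ∈ S, ∃ ns', ns = l ++ ns' := by
  rw [lang, mem_act_mul, he]
  simp only [← lang.eq_1, mem_lang_anyWord, and_true]

/-- The words with fewer than `j` blocks. -/
def fewBlocks (j : ℕ) : PairExp :=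
  sum ((List.range j).map fun i => mul (anyBlocks i) (star (left (ones 1))))

theorem mem_lang_fewBlocks {j : ℕ} {ns : List ℕ} {m : ℕ} :
    blockWord ns m ∈ (fewBlocks j).lang ↔ ns.length < j := by
  have h : ∀ ns' : List ℕ, blockWord ns' m ∈ (star (left (ones 1))).act {[]} ↔ ns' = [] := by
    intro ns'
    rw [mem_act_star_ones]
    constructor
    · rintro ⟨n, _, rfl, h⟩
      rw [List.append_nil, mul_one, ← blockWord_nil] at h
      exact (blockWord_inj h).1
    · rintro rfl
      exact ⟨m, [], rfl, by simp [blockWord_nil]⟩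
  simp only [lang, fewBlocks, mem_act_sum_map, mem_act_mul,
    consumes_anyBlocks _ _ _ _, h]
  constructor
  · rintro ⟨i, hi, l, hl, _, rfl, rfl⟩
    have hl : l.length = i := hl
    simpa [hl] using hi
  · intro hj
    exact ⟨ns.length, by simpa using hj, ns, rfl, [], by simp, rfl⟩

/-! ### Expressions that compare two blocks -/

/-- The pair `(1^i, 1^j)`, or `(1^j, 1^i)`. -/
def onesPair (side : Bool) (i j : ℕ) : PairExp :=
  bif side then atom (ones i) (ones j) else atom (ones j) (ones i)

/-- The expression consists of the pairs `onesPair side i j` with `S i j`. -/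
def Counts (side : Bool) (e : PairExp) (S : ℕ → ℕ → Prop) : Prop :=
  ∀ (A : Set (List Bool)) (x : List Bool),
    x ∈ e.act A ↔ ∃ i j, S i j ∧ x ∈ (onesPair side i j).act A

theorem Counts.congr {side : Bool} {e : PairExp} {S S' : ℕ → ℕ → Prop} (h : Counts side e S)
    (hS : ∀ i j, S i j ↔ S' i j) : Counts side e S' := by
  intro A x
  simp only [h A x, hS]

theorem counts_onesPair (side : Bool) (i j : ℕ) :
    Counts side (onesPair side i j) fun i' j' => i' = i ∧ j' = j := by
  intro A x
  constructor
  · exact fun h => ⟨i, j, ⟨rfl, rfl⟩, h⟩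
  · rintro ⟨_, _, ⟨rfl, rfl⟩, h⟩
    exact h

theorem act_onesPair_add (side : Bool) (i j i' j' : ℕ) (A : Set (List Bool)) :
    (onesPair side (i + i') (j + j')).act A =
      (onesPair side i j).act ((onesPair side i' j').act A) := by
  have h : ∀ a b a' b' : ℕ, (atom (ones (a + a')) (ones (b + b'))).act A =
      (atom (ones a) (ones b)).act ((atom (ones a') (ones b')).act A) := by
    intro a b a' b'
    ext x
    simp only [act, Set.mem_ofPred_eq]
    constructor
    · rintro ⟨y, hy, rfl⟩
      refine ⟨_, ⟨y, hy, rfl⟩, ?_⟩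
      simp only [add_comm b b', List.replicate_add, List.append_assoc]
    · rintro ⟨_, ⟨y, hy, rfl⟩, rfl⟩
      refine ⟨y, hy, ?_⟩
      simp only [add_comm b b', List.replicate_add, List.append_assoc]
  cases side
  · exact h j i j' i'
  · exact h i j i' j'

theorem Counts.mul {side : Bool} {a b : PairExp} {S S' : ℕ → ℕ → Prop} (ha : Counts side a S)
    (hb : Counts side b S') : Counts side (mul a b) fun i j =>
      ∃ i₁ j₁ i₂ j₂, S i₁ j₁ ∧ S' i₂ j₂ ∧ i = i₁ + i₂ ∧ j = j₁ + j₂ := by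
  intro A x
  rw [mem_act_mul, ha]
  constructor
  · rintro ⟨i, j, hij, h⟩
    obtain ⟨y, hy, h⟩ := act_pointwise _ h
    obtain ⟨i', j', hij', h'⟩ := (hb A y).1 hy
    refine ⟨_, _, ⟨i, j, i', j', hij, hij', rfl, rfl⟩, ?_⟩
    rw [act_onesPair_add]
    exact act_mono _ (Set.singleton_subset_iff.2 h') h
  · rintro ⟨_, _, ⟨i, j, i', j', hij, hij', rfl, rfl⟩, h⟩
    rw [act_onesPair_add] at h
    exact ⟨i, j, hij, act_mono _ (fun y hy => (hb A y).2 ⟨i', j', hij', hy⟩) h⟩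

theorem Counts.add {side : Bool} {a b : PairExp} {S S' : ℕ → ℕ → Prop} (ha : Counts side a S)
    (hb : Counts side b S') : Counts side (add a b) fun i j => S i j ∨ S' i j := by
  intro A x
  rw [mem_act_add, ha, hb]
  simp only [or_and_right, exists_or]

theorem Counts.sum {side : Bool} {ι : Type*} {l : List ι} {f : ι → PairExp}
    {S : ι → ℕ → ℕ → Prop} (h : ∀ i, Counts side (f i) (S i)) :
    Counts side (sum (l.map f)) fun i j => ∃ k ∈ l, S k i j := by
  intro A x
  simp only [mem_act_sum_map, h _ A x]
  constructor
  · rintro ⟨k, hk, i, j, hij, h⟩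
    exact ⟨i, j, ⟨k, hk, hij⟩, h⟩
  · rintro ⟨i, j, ⟨k, hk, hij⟩, h⟩
    exact ⟨k, hk, i, j, hij, h⟩

theorem counts_star_onesPair (side : Bool) (i j : ℕ) :
    Counts side (star (onesPair side i j)) fun i' j' => ∃ n, i' = n * i ∧ j' = n * j := by
  intro A x
  have h : ∀ n, (onesPair side i j).act^[n] A = (onesPair side (n * i) (n * j)).act A := by
    intro n
    induction n with
    | zero =>
      ext x
      cases side <;> simp [onesPair, act]
    | succ n ih =>
      rw [Function.iterate_succ_apply', ih, ← act_onesPair_add]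
      congr 2 <;> ring
  change x ∈ ⋃ n : ℕ, (onesPair side i j).act^[n] A ↔ _
  simp only [Set.mem_iUnion, h]
  constructor
  · rintro ⟨n, hn⟩
    exact ⟨_, _, ⟨n, rfl, rfl⟩, hn⟩
  · rintro ⟨_, _, ⟨n, rfl, rfl⟩, hn⟩
    exact ⟨n, hn⟩

/-- The pairs of numbers `a, b` with `b ≠ k a + s`. -/
def mismatch (side : Bool) (k s : ℕ) : PairExp :=
  mul (star (onesPair side 1 k)) <|
    add (sum ((List.range s).map fun t => onesPair side 0 t)) <|
      add (mul (onesPair side 0 (s + 1)) (star (onesPair side 0 1)))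
        (mul (onesPair side 1 0) (mul (star (onesPair side 1 0))
          (sum ((List.range k).map fun t => onesPair side 0 t))))

/-- Remove `n` copies of the pair `(1, k)`. Three leftovers witness an inequality: `a` is used up
and fewer than `s` units of `b` remain; more than `s` units of `b` remain; or something of `a`
remains with fewer than `k` units of `b`. -/
theorem counts_mismatch (side : Bool) {k : ℕ} (hk : 0 < k) (s : ℕ) :
    Counts side (mismatch side k s) fun a b => b ≠ k * a + s := by
  refine ((counts_star_onesPair side 1 k).mul
    ((Counts.sum fun t => counts_onesPair side 0 t).add
      (((counts_onesPair side 0 (s + 1)).mul (counts_star_onesPair side 0 1)).add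
        ((counts_onesPair side 1 0).mul ((counts_star_onesPair side 1 0).mul
          (Counts.sum fun t => counts_onesPair side 0 t)))))).congr fun a b => ?_
  constructor
  · rintro ⟨_, _, i, j, ⟨n, rfl, rfl⟩, h, rfl, rfl⟩
    rcases h with ⟨t, ht, rfl, rfl⟩ | ⟨_, _, _, _, ⟨rfl, rfl⟩, ⟨n', rfl, rfl⟩, rfl, rfl⟩ |
      ⟨_, _, _, _, ⟨rfl, rfl⟩, ⟨_, _, _, _, ⟨n', rfl, rfl⟩, ⟨t, ht, rfl, rfl⟩, rfl, rfl⟩, rfl, rfl⟩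
    · rw [List.mem_range] at ht
      rw [mul_comm k]
      simp
      omega
    · rw [mul_comm k]
      simp
      omega
    · rw [List.mem_range] at ht
      have : n * k + k ≤ k * (n * 1 + (1 + (n' * 1 + 0))) := by nlinarith [Nat.zero_le (k * n')]
      omega
  · intro h
    rcases Nat.lt_trichotomy b (k * a + s) with h1 | h1 | h1
    -- If `b` is too small, either `b` runs out first, leaving `b % k` after `b / k` copies, or all
    -- of `a` can be removed and what remains of `b` is below `s`.
    · by_cases h2 : b / k < a
      · refine ⟨b / k, b / k * k, a - b / k, b % k, ⟨b / k, by simp, rfl⟩, .inr (.inr ?_), by omega,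
          (Nat.div_add_mod' b k).symm⟩
        exact ⟨1, 0, a - b / k - 1, b % k, ⟨rfl, rfl⟩, ⟨a - b / k - 1, 0, 0, b % k,
          ⟨a - b / k - 1, by simp, by simp⟩, ⟨b % k, List.mem_range.2 (Nat.mod_lt _ hk), rfl, rfl⟩,
          by simp, by simp⟩, by omega, by simp⟩
      · have h3 : a * k ≤ b := (Nat.le_div_iff_mul_le hk).1 (not_lt.1 h2)
        refine ⟨a, a * k, 0, b - a * k, ⟨a, by simp, rfl⟩, .inl ⟨b - a * k, ?_, rfl, rfl⟩, rfl,
          by omega⟩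
        rw [mul_comm] at h1
        exact List.mem_range.2 (by omega)
    · exact absurd h1 h
    · rw [mul_comm] at h1
      refine ⟨a, a * k, 0, b - a * k, ⟨a, by simp, rfl⟩, .inr (.inl ?_), rfl, by omega⟩
      exact ⟨0, s + 1, 0, b - a * k - (s + 1), ⟨rfl, rfl⟩, ⟨b - a * k - (s + 1), by simp, by simp⟩,
        by simp, by omega⟩

/-- The words whose first block `a` and block number `j + 1` (counted from `0`) `b` satisfy
`b ≠ k a + s` (or `a ≠ k b + s`, if `side` is false). -/
def mismatchAt (side : Bool) (k s j : ℕ) : PairExp :=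
  mul (star (add (atom [] [false]) (atom [] [true]))) <| mul (atom [] [false]) <|
    mul (mismatch side k s) <| mul (left [false]) (anyBlocks j)

theorem mem_act_anyRight {A : Set (List Bool)} {x : List Bool} :
    x ∈ (star (add (atom [] [false]) (atom [] [true]))).act A ↔ ∃ y ∈ A, ∃ z, x = y ++ z := by
  constructor
  · intro h
    obtain ⟨n, hn⟩ := Set.mem_iUnion.1 h
    clear h
    induction n generalizing x with
    | zero => exact ⟨x, hn, [], by simp⟩
    | succ n ih =>
      rw [Function.iterate_succ_apply'] at hn
      rcases hn with ⟨u, hu, rfl⟩ | ⟨u, hu, rfl⟩ <;> obtain ⟨y, hy, z, rfl⟩ := ih hu <;>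
        exact ⟨y, hy, _, by rw [List.nil_append, List.append_assoc]⟩
  · rintro ⟨y, hy, z, rfl⟩
    induction z using List.reverseRecOn with
    | nil => exact mem_act_star.2 (.inl (by simpa using hy))
    | append_singleton z b ih =>
      refine mem_act_star.2 (.inr ?_)
      cases b
      · exact .inl ⟨_, ih, by simp⟩
      · exact .inr ⟨_, ih, by simp⟩

/-- The expression is read from outside inwards: an arbitrary suffix, the `0` closing the second
compared block, the two unary blocks generated together, and finally the `0` closing the first block
with the `j` blocks in between. The comparison is thus the nested one that a linear grammar can
make. -/
theorem mem_lang_mismatchAt {side : Bool} {k : ℕ} (hk : 0 < k) {s j : ℕ} {ns : List ℕ} {m : ℕ} :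
    blockWord ns m ∈ (mismatchAt side k s j).lang ↔
      ∃ a b l ns', ns = a :: (l ++ b :: ns') ∧ l.length = j ∧
        bif side then b ≠ k * a + s else a ≠ k * b + s := by
  -- The core is the word up to, but without, the `0` that closes the block `b`, so `b` appears as
  -- the trailing run of ones.
  have hcore : ∀ y, y ∈ (mul (mismatch side k s) (mul (left [false]) (anyBlocks j))).lang ↔
      ∃ a b l, l.length = j ∧ (bif side then b ≠ k * a + s else a ≠ k * b + s) ∧
        y = blockWord (a :: l) b := by
    intro y
    have hl : ∀ z, z ∈ (mul (left [false]) (anyBlocks j)).act {[]} ↔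
        ∃ l : List ℕ, l.length = j ∧ z = false :: blocks l := by
      intro z
      rw [mem_act_mul, mem_act_left]
      constructor
      · rintro ⟨z, hz, rfl⟩
        obtain ⟨ns, m, rfl⟩ := exists_blockWord z
        obtain ⟨l, hl, ns', rfl, h⟩ := (consumes_anyBlocks j _ _ _).1 hz
        rw [blockWord_append, Set.mem_singleton_iff.1 h]
        exact ⟨l, hl, by simp⟩
      · rintro ⟨l, hl, rfl⟩
        refine ⟨blocks l, ?_, rfl⟩
        have : blocks l = blockWord l 0 := by simp [blockWord]
        rw [this]
        exact (consumes_anyBlocks j _ _ _).2 ⟨l, hl, [], by simp, rfl⟩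
    rw [lang, mem_act_mul, counts_mismatch side hk s]
    cases side
    · simp only [onesPair, cond_false, act, Set.mem_ofPred_eq] at hl ⊢
      constructor
      · rintro ⟨b, a, h, _, hz, rfl⟩
        obtain ⟨l, hl, rfl⟩ := (hl _).1 hz
        exact ⟨a, b, l, hl, h, by simp [blocks, blockWord]⟩
      · rintro ⟨a, b, l, hl', h, rfl⟩
        exact ⟨b, a, h, _, (hl _).2 ⟨l, hl', rfl⟩, by simp [blocks, blockWord]⟩
    · simp only [onesPair, cond_true, act, Set.mem_ofPred_eq] at hl ⊢
      constructor
      · rintro ⟨a, b, h, _, hz, rfl⟩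
        obtain ⟨l, hl, rfl⟩ := (hl _).1 hz
        exact ⟨a, b, l, hl, h, by simp [blocks, blockWord]⟩
      · rintro ⟨a, b, l, hl', h, rfl⟩
        exact ⟨a, b, h, _, (hl _).2 ⟨l, hl', rfl⟩, by simp [blocks, blockWord]⟩
  rw [lang, mismatchAt, mem_act_mul, mem_act_anyRight]
  constructor
  · rintro ⟨_, ⟨y, hy, rfl⟩, z, h⟩
    obtain ⟨a, b, l, hl, hab, rfl⟩ := (hcore y).1 hy
    have h' : blockWord ns m = blocks (a :: (l ++ [b])) ++ z := by
      rw [h]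
      simp [blockWord, blocks]
    obtain ⟨ns', rfl, -⟩ := blockWord_eq_blocks_append.1 h'
    exact ⟨a, b, l, ns', by simp, hl, hab⟩
  · rintro ⟨a, b, l, ns', rfl, hl, hab⟩
    refine ⟨_, ⟨_, (hcore _).2 ⟨a, b, l, hl, hab, rfl⟩, rfl⟩, blockWord ns' m, ?_⟩
    have : a :: (l ++ b :: ns') = (a :: l) ++ b :: ns' := rfl
    rw [this, blockWord_append, blockWord_cons]
    simp [blockWord]

end PairExp

/-! ### Machines with four registers that hold base-five stacks -/

/-- The operations on a register: to keep it, or to push or pop its last digit in base five. -/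
inductive StackOp
  | keep
  | push (s : Fin 5)
  | pop

/-- The effect of an operation. -/
def StackOp.app : StackOp → ℕ → ℕ
  | keep, n => n
  | push s, n => 5 * n + s
  | pop, n => n / 5

/-- A machine with four registers. In state `q` it reads the last digit in base five of the register
`reg q`, operates on that register and changes its state. -/
structure RegMachine (Q : Type) where
  reg : Q → Fin 4
  next : Q → Fin 5 → Q
  op : Q → Fin 5 → StackOp
  halting : Q → Prop

namespace RegMachine

variable {Q : Type} (M : RegMachine Q)

/-- The digit that is read. -/
def digit (c : Q × (Fin 4 → ℕ)) : Fin 5 :=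
  ⟨c.2 (M.reg c.1) % 5, Nat.mod_lt _ (by norm_num)⟩

/-- One step of the machine. -/
def step (c : Q × (Fin 4 → ℕ)) : Q × (Fin 4 → ℕ) :=
  (M.next c.1 (M.digit c),
    Function.update c.2 (M.reg c.1) ((M.op c.1 (M.digit c)).app (c.2 (M.reg c.1))))

/-- The operation of the machine on the register `j`. -/
def regOp (s : Q × Fin 5) (j : Fin 4) : StackOp :=
  if j = M.reg s.1 then M.op s.1 s.2 else .keep

theorem app_regOp (κ : Q × (Fin 4 → ℕ)) (j : Fin 4) :
    (M.step κ).2 j = (M.regOp (κ.1, M.digit κ) j).app (κ.2 j) := by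
  unfold step regOp
  by_cases hj : j = M.reg κ.1
  · subst hj
    simp
  · simp [hj, StackOp.app]

/-- A pop acts only on the register being read, so its last digit is the recorded one. This makes a
pop the linear relation `a = 5 * b + d` between old and new value. -/
theorem mod_of_regOp_eq_pop {κ : Q × (Fin 4 → ℕ)} {j : Fin 4}
    (h : M.regOp (κ.1, M.digit κ) j = .pop) : κ.2 j % 5 = M.digit κ := by
  unfold regOp at h
  split_ifs at h with hj
  subst hj
  rfl

/-- The list consists of the successive configurations of a halting computation. -/
structure IsHistory (cs : List (Q × (Fin 4 → ℕ))) : Prop where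
  succ : ∀ cs₁ κ κ' cs₂, cs = cs₁ ++ κ :: κ' :: cs₂ → κ' = M.step κ
  last : ∃ cs₁ κ, cs = cs₁ ++ [κ] ∧ M.halting κ.1

theorem isHistory_of_halting {c : Q × (Fin 4 → ℕ)} {n : ℕ} (h : M.halting (M.step^[n] c).1) :
    M.IsHistory ((List.range (n + 1)).map fun i => M.step^[i] c) := by
  constructor
  · intro cs₁ κ κ' cs₂ hcs
    have h1 := congrArg (fun L => L[cs₁.length]?) hcs
    have h2 := congrArg (fun L => L[cs₁.length + 1]?) hcs
    have h3 := congrArg List.length hcs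
    simp only [List.length_map, List.length_range, List.length_append, List.length_cons] at h3
    simp only [List.getElem?_map, List.getElem?_append_right le_rfl,
      List.getElem?_append_right (Nat.le_add_right cs₁.length 1), Nat.sub_self,
      Nat.add_sub_cancel_left, List.getElem?_cons_zero, List.getElem?_cons_succ] at h1 h2
    rw [List.getElem?_range (by omega), Option.map_some, Option.some.injEq] at h1 h2
    rw [← h1, ← h2, Function.iterate_succ_apply']
  · exact ⟨(List.range n).map fun i => M.step^[i] c, M.step^[n] c, by simp [List.range_succ], h⟩

variable [Fintype Q]

/-- The number of a pair of a state and a digit. -/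
noncomputable def code (s : Q × Fin 5) : ℕ :=
  Fintype.equivFin (Q × Fin 5) s

theorem code_injective : Function.Injective (code (Q := Q)) :=
  Fin.val_injective.comp (Fintype.equivFin _).injective

theorem code_lt (s : Q × Fin 5) : code s < Fintype.card (Q × Fin 5) :=
  (Fintype.equivFin (Q × Fin 5) s).2

theorem exists_code {c : ℕ} (h : c < Fintype.card (Q × Fin 5)) : ∃ s : Q × Fin 5, code s = c :=
  ⟨(Fintype.equivFin _).symm ⟨c, h⟩, by simp [code]⟩

/-! ### Histories as words, and expressions for the possible errors -/

/-- A configuration as a list of numbers. -/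
noncomputable def cells (c : Q × (Fin 4 → ℕ)) : List ℕ :=
  code (c.1, M.digit c) :: List.ofFn c.2

theorem length_cells (c : Q × (Fin 4 → ℕ)) : (M.cells c).length = 5 := by
  simp [cells]

open PairExp

/-- Any number of complete configurations. -/
def anyConfigs : PairExp :=
  star (anyBlocks 5)

theorem consumes_anyConfigs : Consumes anyConfigs {l | 5 ∣ l.length} := by
  refine (consumes_anyBlocks 5).star.congr fun l => ?_
  constructor
  · rintro ⟨ls, hls, rfl⟩
    change 5 ∣ ls.flatten.length
    rw [List.length_flatten]
    refine List.dvd_sum fun n hn => ?_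
    obtain ⟨u, hu, rfl⟩ := List.mem_map.1 hn
    have : u.length = 5 := hls u hu
    simp [this]
  · rintro ⟨n, hn⟩
    induction n generalizing l with
    | zero => exact ⟨[], by simp, List.length_eq_zero_iff.1 hn⟩
    | succ n ih =>
      obtain ⟨ls, hls, h⟩ := ih (l.drop 5) (by rw [List.length_drop]; omega)
      refine ⟨l.take 5 :: ls, ?_, ?_⟩
      · intro u hu
        rcases List.mem_cons.1 hu with rfl | hu
        · change (l.take 5).length = 5
          rw [List.length_take]
          omega
        · exact hls u hu
      · rw [List.flatten_cons, ← h, List.take_append_drop]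

/-- The list `l` occurs in `ns` at the start of a configuration. -/
def OccursAt (l ns : List ℕ) : Prop :=
  ∃ pre post, 5 ∣ pre.length ∧ ns = pre ++ (l ++ post)

/-- The words in which something occurs at the start of a configuration. -/
def occurring (e : PairExp) : PairExp :=
  mul (mul anyConfigs e) anyWord

theorem mem_lang_occurring {e : PairExp} {S : Set (List ℕ)} (he : Consumes e S) {ns : List ℕ}
    {m : ℕ} : blockWord ns m ∈ (occurring e).lang ↔ ∃ l ∈ S, OccursAt l ns := by
  rw [occurring, mem_lang_mul_anyWord (consumes_anyConfigs.mul he)]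
  constructor
  · rintro ⟨_, ⟨u, hu, v, hv, rfl⟩, ns', rfl⟩
    exact ⟨v, hv, u, ns', hu, by simp⟩
  · rintro ⟨v, hv, u, ns', hu, rfl⟩
    exact ⟨_, ⟨u, hu, v, hv, rfl⟩, ns', by simp⟩

variable (Q) in
/-- A configuration begins with a number that is not the code of a state and a digit. -/
noncomputable def badCode : PairExp :=
  occurring (blockMod 1 (Fintype.card (Q × Fin 5)))

theorem mem_lang_badCode {ns : List ℕ} {m : ℕ} :
    blockWord ns m ∈ (badCode Q).lang ↔
      ∃ c, Fintype.card (Q × Fin 5) ≤ c ∧ OccursAt [c] ns := by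
  rw [badCode, mem_lang_occurring (consumes_blockMod _ _)]
  constructor
  · rintro ⟨_, ⟨n, rfl⟩, h⟩
    exact ⟨_, Nat.le_add_left _ _, h⟩
  · rintro ⟨c, hc, h⟩
    exact ⟨_, ⟨c - Fintype.card (Q × Fin 5), rfl⟩, by rwa [mul_one, Nat.sub_add_cancel hc]⟩

open Classical in
/-- A configuration names a wrong digit. -/
noncomputable def badDigit : PairExp :=
  sum (((Finset.univ : Finset ((Q × Fin 5) × Fin 5)).filter fun t => t.2 ≠ t.1.2).toList.map
    fun t => occurring (mul (block (code t.1))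
      (mul (anyBlocks (M.reg t.1.1)) (blockMod 5 t.2))))

theorem mem_lang_badDigit {ns : List ℕ} {m : ℕ} :
    blockWord ns m ∈ M.badDigit.lang ↔ ∃ (s : Q × Fin 5) (l : List ℕ) (v : ℕ),
      l.length = M.reg s.1 ∧ v % 5 ≠ s.2 ∧ OccursAt (code s :: (l ++ [v])) ns := by
  rw [lang, badDigit, mem_act_sum_map]
  have h : ∀ t : (Q × Fin 5) × Fin 5, _ := fun t => mem_lang_occurring (ns := ns) (m := m)
    ((consumes_block (code t.1)).mul ((consumes_anyBlocks (M.reg t.1.1)).mul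
      (consumes_blockMod 5 t.2)))
  simp only [← lang.eq_1, h]
  constructor
  · rintro ⟨⟨s, e⟩, hs, _, ⟨_, rfl, _, ⟨l, hl, _, ⟨n, rfl⟩, rfl⟩, rfl⟩, h⟩
    refine ⟨s, l, n * 5 + e, hl, ?_, h⟩
    have he : e ≠ s.2 := by simpa using hs
    intro h'
    refine he (Fin.ext ?_)
    have := e.2
    omega
  · rintro ⟨s, l, v, hl, hv, h⟩
    refine ⟨(s, ⟨v % 5, Nat.mod_lt _ (by norm_num)⟩), ?_, _, ⟨_, rfl, _, ⟨l, hl, _, ⟨v / 5, rfl⟩,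
      rfl⟩, rfl⟩, ?_⟩
    · simp only [Finset.mem_toList, Finset.mem_filter, Finset.mem_univ, true_and]
      exact fun h' => hv (congrArg Fin.val h')
    · rw [Nat.div_add_mod']
      exact h

open Classical in
/-- The state of a configuration is not the successor of the previous one. -/
noncomputable def badNext : PairExp :=
  sum (((Finset.univ : Finset ((Q × Fin 5) × (Q × Fin 5))).filter fun t =>
    ¬ M.halting t.1.1 ∧ t.2.1 ≠ M.next t.1.1 t.1.2).toList.map fun t =>
      occurring (mul (block (code t.1)) (mul (anyBlocks 4) (block (code t.2)))))

theorem mem_lang_badNext {ns : List ℕ} {m : ℕ} :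
    blockWord ns m ∈ M.badNext.lang ↔ ∃ (s s' : Q × Fin 5) (l : List ℕ), l.length = 4 ∧
      ¬ M.halting s.1 ∧ s'.1 ≠ M.next s.1 s.2 ∧ OccursAt (code s :: (l ++ [code s'])) ns := by
  rw [lang, badNext, mem_act_sum_map]
  have h : ∀ t : (Q × Fin 5) × (Q × Fin 5), _ := fun t => mem_lang_occurring (ns := ns) (m := m)
    ((consumes_block (code t.1)).mul ((consumes_anyBlocks 4).mul (consumes_block (code t.2))))
  simp only [← lang.eq_1, h, Finset.mem_toList, Finset.mem_filter, Finset.mem_univ, true_and]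
  constructor
  · rintro ⟨⟨s, s'⟩, ⟨hs, hs'⟩, _, ⟨_, rfl, _, ⟨l, hl, _, rfl, rfl⟩, rfl⟩, h⟩
    exact ⟨s, s', l, hl, hs, hs', h⟩
  · rintro ⟨s, s', l, hl, hs, hs', h⟩
    exact ⟨(s, s'), ⟨hs, hs'⟩, _, ⟨_, rfl, _, ⟨l, hl, _, rfl, rfl⟩, rfl⟩, h⟩

/-- The words whose first and sixth block are not related by the operation. -/
def opMismatch (d : Fin 5) : StackOp → PairExp
  | .keep => mismatchAt true 1 0 4
  | .push s => mismatchAt true 5 s 4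
  | .pop => mismatchAt false 5 d 4

/-- Pushing gives `b = 5 * a + s`. Popping with known digit `d < 5` is the same relation with the
roles exchanged, because `a = 5 * b + d` holds exactly when `b = a / 5` and `a % 5 = d`. -/
theorem mem_lang_opMismatch {d : Fin 5} {o : StackOp} {ns : List ℕ} {m : ℕ} :
    blockWord ns m ∈ (opMismatch d o).lang ↔ ∃ a b l ns', ns = a :: (l ++ b :: ns') ∧
      l.length = 4 ∧ ¬ (b = o.app a ∧ (o = .pop → a % 5 = d)) := by
  cases o with
  | keep =>
    rw [opMismatch, mem_lang_mismatchAt one_pos]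
    simp [StackOp.app]
  | push s =>
    rw [opMismatch, mem_lang_mismatchAt (by norm_num)]
    simp [StackOp.app]
  | pop =>
    rw [opMismatch, mem_lang_mismatchAt (by norm_num)]
    have := d.2
    simp only [cond_false, StackOp.app, true_implies]
    refine exists_congr fun a => exists_congr fun b => exists_congr fun l => exists_congr fun ns' =>
      and_congr_right fun _ => and_congr_right fun _ => not_congr ?_
    omega

open Classical in
/-- A register of a configuration does not agree with the previous configuration. -/
noncomputable def badReg : PairExp :=
  sum (((Finset.univ : Finset ((Q × Fin 5) × Fin 4)).filter fun t =>
    ¬ M.halting t.1.1).toList.map fun t =>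
      mul (mul anyConfigs (mul (block (code t.1)) (anyBlocks t.2)))
        (opMismatch t.1.2 (M.regOp t.1 t.2)))

theorem mem_lang_badReg {ns : List ℕ} {m : ℕ} :
    blockWord ns m ∈ M.badReg.lang ↔ ∃ (s : Q × Fin 5) (j : Fin 4) (l l' : List ℕ) (a b : ℕ),
      l.length = j ∧ l'.length = 4 ∧ ¬ M.halting s.1 ∧
        ¬ (b = (M.regOp s j).app a ∧ (M.regOp s j = .pop → a % 5 = s.2)) ∧
          OccursAt (code s :: (l ++ a :: (l' ++ [b]))) ns := by
  rw [lang, badReg, mem_act_sum_map]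
  have h : ∀ (t : (Q × Fin 5) × Fin 4) (e : PairExp), _ := fun t e => consumes_anyConfigs.mul
    ((consumes_block (code t.1)).mul (consumes_anyBlocks t.2)) e.lang ns m
  have h' : ∀ (t : (Q × Fin 5) × Fin 4) (e : PairExp), blockWord ns m ∈
    (mul (mul anyConfigs (mul (block (code t.1)) (anyBlocks t.2))) e).act {[]} ↔ _ := h
  simp only [h', mem_lang_opMismatch, Finset.mem_toList, Finset.mem_filter, Finset.mem_univ,
    true_and]
  constructor
  · rintro ⟨⟨s, j⟩, hs, _, ⟨pre, hpre, _, ⟨_, rfl, l, hl, rfl⟩, rfl⟩, _, rfl, a, b, l', ns', rfl, hl',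
      hab⟩
    exact ⟨s, j, l, l', a, b, hl, hl', hs, hab, pre, ns', hpre, by simp⟩
  · rintro ⟨s, j, l, l', a, b, hl, hl', hs, hab, pre, ns', hpre, rfl⟩
    exact ⟨(s, j), hs, _, ⟨pre, hpre, _, ⟨_, rfl, l, hl, rfl⟩, rfl⟩, _, by simp, a, b, l', ns',
      rfl, hl', hab⟩

open Classical in
/-- No complete configuration is halting. -/
noncomputable def noHalt : PairExp :=
  mul (star (mul (sum (((Finset.univ : Finset (Q × Fin 5)).filter fun s =>
    ¬ M.halting s.1).toList.map fun s => block (code s))) (anyBlocks 4))) (fewBlocks 5)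

/-- A complete configuration that is not halting. -/
def Running (u : List ℕ) : Prop :=
  ∃ (s : Q × Fin 5) (l : List ℕ), ¬ M.halting s.1 ∧ l.length = 4 ∧ u = code s :: l

theorem mem_lang_noHalt {ns : List ℕ} {m : ℕ} :
    blockWord ns m ∈ M.noHalt.lang ↔ ∃ (ls : List (List ℕ)) (rest : List ℕ),
      (∀ u ∈ ls, M.Running u) ∧ ns = ls.flatten ++ rest ∧ rest.length < 5 := by
  classical
  have h := ((Consumes.sum (l := ((Finset.univ : Finset (Q × Fin 5)).filter fun s =>
    ¬ M.halting s.1).toList) fun s => consumes_block (code s)).mul (consumes_anyBlocks 4)).congr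
      (S' := {u | M.Running u}) (by
        intro u
        simp only [Finset.mem_toList, Finset.mem_filter, Finset.mem_univ, true_and]
        constructor
        · rintro ⟨_, ⟨s, hs, rfl⟩, l, hl, rfl⟩
          exact ⟨s, l, hs, hl, rfl⟩
        · rintro ⟨s, l, hs, hl, rfl⟩
          exact ⟨_, ⟨s, hs, rfl⟩, l, hl, rfl⟩)
  rw [lang, noHalt, mem_act_mul, h.star]
  simp only [← lang.eq_1, mem_lang_fewBlocks]
  constructor
  · rintro ⟨_, ⟨ls, hls, rfl⟩, rest, rfl, hr⟩
    exact ⟨ls, rest, hls, rfl, hr⟩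
  · rintro ⟨ls, rest, hls, rfl, hr⟩
    exact ⟨_, ⟨ls, hls, rfl⟩, rest, rfl, hr⟩

/-- The words that are not the history of a halting computation. -/
noncomputable def invalid : PairExp :=
  add (badCode Q) (add M.badDigit (add M.badNext (add M.badReg M.noHalt)))

theorem mem_lang_invalid {x : List Bool} : x ∈ M.invalid.lang ↔ x ∈ (badCode Q).lang ∨
    x ∈ M.badDigit.lang ∨ x ∈ M.badNext.lang ∨ x ∈ M.badReg.lang ∨ x ∈ M.noHalt.lang := Iff.rfl

/-! ### Correctness of histories -/

/-- A configuration occupies five blocks, so a position divisible by five is the start of an actual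
configuration. Each alleged error in a true history can therefore be compared with the machine. -/
theorem exists_of_occursAt_history {cs : List (Q × (Fin 4 → ℕ))} {c : ℕ} {l : List ℕ}
    (h : OccursAt (c :: l) (cs.flatMap M.cells)) : ∃ cs₁ κ cs₂ post, cs = cs₁ ++ κ :: cs₂ ∧
      c = code (κ.1, M.digit κ) ∧ l ++ post = List.ofFn κ.2 ++ cs₂.flatMap M.cells := by
  obtain ⟨pre, post, ⟨n, hn⟩, h⟩ := h
  induction n generalizing cs pre with
  | zero =>
    cases List.length_eq_zero_iff.1 hn
    cases cs with
    | nil => simp at h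
    | cons κ cs =>
      rw [List.flatMap_cons, cells, List.nil_append, List.cons_append, List.cons_append,
        List.cons.injEq] at h
      exact ⟨[], κ, cs, post, rfl, h.1.symm, h.2.symm⟩
  | succ n ih =>
    cases cs with
    | nil => simp at h
    | cons κ cs =>
      have h5 : pre = pre.take 5 ++ pre.drop 5 := (List.take_append_drop 5 pre).symm
      rw [List.flatMap_cons, h5, List.append_assoc] at h
      obtain ⟨-, h⟩ := List.append_inj h (by rw [length_cells, List.length_take]; omega)
      obtain ⟨cs₁, κ', cs₂, post', rfl, h'⟩ := ih (pre.drop 5) h (by rw [List.length_drop]; omega)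
      exact ⟨κ :: cs₁, κ', cs₂, post', rfl, h'⟩

theorem eq_of_append_cons_eq {l post rest : List ℕ} {a : ℕ} {r : Fin 4 → ℕ} {j : Fin 4}
    (hl : l.length = j) (h : l ++ a :: post = List.ofFn r ++ rest) : a = r j := by
  have h1 := congrArg (fun L => L[(j : ℕ)]?) h
  simp only [← hl, List.getElem?_append_right le_rfl, Nat.sub_self, List.getElem?_cons_zero] at h1
  rw [List.getElem?_append_left (by simp [hl]), List.getElem?_ofFn, dif_pos (by simp [hl]),
    Option.some.injEq] at h1
  simpa only [hl] using h1

/-- The same register in successive configurations lies five blocks further on: four blocks in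
between, one of them the code of the next configuration. -/
theorem eq_of_append_cons_append_cons_eq {l l' post : List ℕ} {a b : ℕ} {r : Fin 4 → ℕ}
    {j : Fin 4} {cs : List (Q × (Fin 4 → ℕ))} (hl : l.length = j) (hl' : l'.length = 4)
    (h : l ++ a :: (l' ++ b :: post) = List.ofFn r ++ cs.flatMap M.cells) :
    ∃ κ cs', cs = κ :: cs' ∧ b = κ.2 j := by
  have h1 := congrArg (List.drop 5) h
  have h2 : l ++ a :: (l' ++ b :: post) = (l ++ a :: l') ++ b :: post := by simp
  have h3 : (List.ofFn r ++ cs.flatMap M.cells).drop 5 = (cs.flatMap M.cells).drop 1 := by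
    rw [List.drop_append]
    simp
  rw [h2, List.drop_append_of_le_length (by simp; omega), h3] at h1
  cases cs with
  | nil => simp at h1
  | cons κ cs =>
    refine ⟨κ, cs, rfl, eq_of_append_cons_eq (l := (l ++ a :: l').drop 5) (post := post)
      (rest := cs.flatMap M.cells) ?_ ?_⟩
    · simp
      omega
    · rw [h1]
      rfl

/-- Each error is located at a configuration of the history and contradicts the injectivity or the
range of the coding, the digit read there, or the fact that the next configuration is the result of
a step. Absence of a halting configuration contradicts the last one. -/
theorem history_not_mem_invalid {cs : List (Q × (Fin 4 → ℕ))} (hcs : M.IsHistory cs) :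
    blockWord (cs.flatMap M.cells) 0 ∉ M.invalid.lang := by
  rw [mem_lang_invalid, mem_lang_badCode, mem_lang_badDigit, mem_lang_badNext, mem_lang_badReg,
    mem_lang_noHalt]
  rintro (⟨c, hc, h⟩ | ⟨s, l, v, hl, hv, h⟩ | ⟨s, s', l, hl, -, hs', h⟩ |
    ⟨s, j, l, l', a, b, hl, hl', -, hab, h⟩ | ⟨ls, rest, hls, h, hr⟩)
  · obtain ⟨_, κ, _, _, -, rfl, -⟩ := M.exists_of_occursAt_history h
    exact absurd (code_lt (κ.1, M.digit κ)) (not_lt.2 hc)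
  · obtain ⟨_, κ, _, _, -, hs, h'⟩ := M.exists_of_occursAt_history h
    cases code_injective hs
    rw [List.append_assoc] at h'
    cases eq_of_append_cons_eq hl h'
    exact hv rfl
  · obtain ⟨cs₁, κ, cs₂, _, rfl, hs, h'⟩ := M.exists_of_occursAt_history h
    cases code_injective hs
    rw [List.append_assoc] at h'
    have h := (List.append_inj h' (by simp [hl])).2
    cases cs₂ with
    | nil => simp at h
    | cons κ' cs₂ =>
      rw [List.flatMap_cons, cells, List.cons_append, List.cons_append, List.cons.injEq] at h
      cases code_injective h.1
      exact hs' (congrArg Prod.fst (hcs.succ _ _ _ _ rfl))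
  · obtain ⟨cs₁, κ, cs₂, post, rfl, hs, h'⟩ := M.exists_of_occursAt_history h
    cases code_injective hs
    have h : l ++ a :: (l' ++ b :: post) = List.ofFn κ.2 ++ cs₂.flatMap M.cells := by
      rw [← h']
      simp
    obtain ⟨κ', cs', rfl, rfl⟩ := M.eq_of_append_cons_append_cons_eq hl hl' h
    cases eq_of_append_cons_eq hl h
    cases hcs.succ _ _ _ _ rfl
    exact hab ⟨M.app_regOp κ j, M.mod_of_regOp_eq_pop⟩
  -- The number of blocks is a multiple of five, so no incomplete configuration is left over and the
  -- last running chunk coincides with the halting configuration.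
  · obtain ⟨cs₁, κ, rfl, hκ⟩ := hcs.last
    have hlen : ∀ cs : List (Q × (Fin 4 → ℕ)), 5 ∣ (cs.flatMap M.cells).length := by
      intro cs
      rw [List.length_flatMap]
      refine List.dvd_sum fun n hn => ?_
      obtain ⟨c, -, rfl⟩ := List.mem_map.1 hn
      rw [length_cells]
    have hlen' : 5 ∣ ls.flatten.length := by
      rw [List.length_flatten]
      refine List.dvd_sum fun n hn => ?_
      obtain ⟨u, hu, rfl⟩ := List.mem_map.1 hn
      obtain ⟨s, l, -, hl, rfl⟩ := hls u hu
      simp [hl]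
    obtain rfl : rest = [] := by
      have h1 := hlen (cs₁ ++ [κ])
      rw [h, List.length_append] at h1
      exact List.length_eq_zero_iff.1 (by omega)
    rw [List.append_nil, List.flatMap_append, List.flatMap_singleton] at h
    rcases List.eq_nil_or_concat ls with rfl | ⟨ls, u, rfl⟩
    · simp [cells] at h
    · obtain ⟨s, l, hs, hl, rfl⟩ := hls u (by simp)
      simp only [List.concat_eq_append, List.flatten_append, List.flatten_singleton] at h
      have h := (List.append_inj' h (by simp [length_cells, hl])).2
      rw [cells, List.cons.injEq] at h
      cases code_injective h.1
      exact hs hκ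

/-- The word is followed one configuration at a time. Unless `κ` halts, the absence of errors forces
the next five blocks to exist and to be the cells of `M.step κ`; `post` shrinks each time, so a
halting configuration is reached inside the word. What stands after it is irrelevant. -/
theorem exists_halting_of_not_mem_invalid {pre post : List ℕ} {κ : Q × (Fin 4 → ℕ)} {m : ℕ}
    {ls : List (List ℕ)} (hls : ∀ u ∈ ls, M.Running u) (hpre : pre = ls.flatten)
    (h : blockWord (pre ++ (M.cells κ ++ post)) m ∉ M.invalid.lang) :
    ∃ n, M.halting (M.step^[n] κ).1 ∧
      ∀ i, (M.step^[n] κ).2 i ∈ pre ++ (M.cells κ ++ post) := by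
  by_cases hκ : M.halting κ.1
  · have hmem : ∀ i, κ.2 i ∈ M.cells κ := fun i =>
      List.mem_cons_of_mem _ (List.mem_ofFn.2 ⟨i, rfl⟩)
    exact ⟨0, hκ, fun i => List.mem_append_right _ (List.mem_append_left _ (hmem i))⟩
  have hinv := h
  rw [mem_lang_invalid, mem_lang_badCode, mem_lang_badDigit, mem_lang_badNext, mem_lang_badReg,
    mem_lang_noHalt] at hinv
  push Not at hinv
  obtain ⟨hcode, hdigit, hnext, hreg, hnohalt⟩ := hinv
  have hrun : M.Running (M.cells κ) := ⟨_, _, hκ, by simp, rfl⟩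
  have hpre5 : 5 ∣ pre.length := by
    rw [hpre, List.length_flatten]
    refine List.dvd_sum fun n hn => ?_
    obtain ⟨u, hu, rfl⟩ := List.mem_map.1 hn
    obtain ⟨s, l, -, hl, rfl⟩ := hls u hu
    simp [hl]
  have hls' : ∀ u ∈ ls ++ [M.cells κ], M.Running u := by
    intro u hu
    rcases List.mem_append.1 hu with hu | hu
    · exact hls u hu
    · cases List.mem_singleton.1 hu
      exact hrun
  -- All complete configurations so far are running, so fewer than five further blocks would put the
  -- word into `noHalt`.
  have hpost := hnohalt (ls ++ [M.cells κ]) post hls' (by simp [hpre])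
  obtain ⟨c, r, post', hr, rfl⟩ : ∃ c r post', r.length = 4 ∧ post = c :: (r ++ post') := by
    cases post with
    | nil => simp at hpost
    | cons c post =>
      rw [List.length_cons] at hpost
      exact ⟨c, post.take 4, post.drop 4, by rw [List.length_take]; omega,
        by rw [List.take_append_drop]⟩
  obtain ⟨r, rfl⟩ : ∃ r' : Fin 4 → ℕ, r = List.ofFn r' :=
    ⟨fun i => r.get (i.cast hr.symm), by
      refine List.ext_get (by rw [List.length_ofFn, hr]) fun n h1 h2 => ?_
      simp only [List.get_eq_getElem, List.getElem_ofFn, Fin.val_cast]⟩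
  have hocc : ∀ l post'', M.cells κ ++ (c :: (List.ofFn r ++ post')) = l ++ post'' →
      OccursAt l (pre ++ (M.cells κ ++ (c :: (List.ofFn r ++ post')))) := fun l post'' hl =>
    ⟨pre, post'', hpre5, by rw [hl]⟩
  have hocc' : ∀ l post'', c :: (List.ofFn r ++ post') = l ++ post'' →
      OccursAt l (pre ++ (M.cells κ ++ (c :: (List.ofFn r ++ post')))) := fun l post'' hl =>
    ⟨pre ++ M.cells κ, post'', by
      rw [List.length_append, length_cells]
      omega, by rw [hl, List.append_assoc]⟩
  obtain ⟨s, rfl⟩ := exists_code (Q := Q) (c := c) (by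
    by_contra hc
    exact hcode c (not_lt.1 hc) (hocc' [c] _ rfl))
  have hs1 : s.1 = (M.step κ).1 := by
    by_contra hs
    exact hnext (κ.1, M.digit κ) s (List.ofFn κ.2) (by simp) hκ hs
      (hocc _ (List.ofFn r ++ post') (by simp [cells]))
  have hr' : r = (M.step κ).2 := by
    funext j
    by_contra hj
    refine hreg (κ.1, M.digit κ) j ((List.ofFn κ.2).take j)
      ((List.ofFn κ.2).drop (j + 1) ++ code s :: (List.ofFn r).take j) (κ.2 j) (r j)
      (by simp) (by simp; omega) hκ (fun h => absurd (h.trans (M.app_regOp κ j).symm) hj)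
      (hocc _ ((List.ofFn r).drop (j + 1) ++ post') ?_)
    have h1 : ∀ r : Fin 4 → ℕ, List.ofFn r =
        (List.ofFn r).take j ++ r j :: (List.ofFn r).drop (j + 1) := by
      intro r
      have : r j = (List.ofFn r)[(j : ℕ)]'(by simp) := by simp only [List.getElem_ofFn]
      rw [this, List.cons_getElem_drop_succ, List.take_append_drop]
    conv_lhs => rw [cells, h1 κ.2, h1 r]
    simp only [List.cons_append, List.append_assoc, List.nil_append]
  -- The new digit can be checked only now: which register it refers to, and what that register
  -- contains, is given by `hs1` and `hr'`.
  have hs2 : s.2 = M.digit (M.step κ) := by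
    by_contra hs
    have h1 : List.ofFn r =
        (List.ofFn r).take (M.reg s.1) ++ r (M.reg s.1) :: (List.ofFn r).drop (M.reg s.1 + 1) := by
      have : r (M.reg s.1) = (List.ofFn r)[(M.reg s.1 : ℕ)]'(by simp) := by
        simp only [List.getElem_ofFn]
      rw [this, List.cons_getElem_drop_succ, List.take_append_drop]
    refine hdigit s ((List.ofFn r).take (M.reg s.1)) (r (M.reg s.1)) (by simp) ?_
      (hocc' _ ((List.ofFn r).drop (M.reg s.1 + 1) ++ post') ?_)
    · intro h2
      refine hs (Fin.ext ?_)
      rw [← h2, hr', hs1]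
      rfl
    · conv_lhs => rw [h1]
      simp
  have hcells : code s :: List.ofFn r = M.cells (M.step κ) := by
    rw [cells, ← hr', ← hs1, ← hs2]
  have hns : pre ++ (M.cells κ ++ code s :: (List.ofFn r ++ post')) =
      (pre ++ M.cells κ) ++ (M.cells (M.step κ) ++ post') := by
    rw [← hcells]
    simp
  rw [hns] at h ⊢
  obtain ⟨n, hn, hmem⟩ := exists_halting_of_not_mem_invalid hls' (by simp [hpre]) h
  exact ⟨n + 1, hn, hmem⟩
termination_by post.length
decreasing_by
  subst_vars
  simp only [List.length_cons, List.length_append]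
  omega

theorem le_length_blockWord {ns : List ℕ} {m k : ℕ} (h : k ∈ ns) :
    k ≤ (blockWord ns m).length := by
  obtain ⟨l, l', rfl⟩ := List.append_of_mem h
  rw [blockWord_append, blockWord_cons]
  simp
  omega

/-- The words that are not a halting computation from the configuration `c`. -/
noncomputable def invalidFrom (c : Q × (Fin 4 → ℕ)) : PairExp :=
  add M.invalid (notPrefix (blocks (M.cells c)))

theorem mem_lang_invalidFrom {c : Q × (Fin 4 → ℕ)} {x : List Bool} :
    x ∈ (M.invalidFrom c).lang ↔ x ∈ M.invalid.lang ∨ ¬ blocks (M.cells c) <+: x := by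
  rw [← mem_lang_notPrefix]
  rfl

theorem exists_not_mem_invalidFrom {c : Q × (Fin 4 → ℕ)} {n : ℕ}
    (h : M.halting (M.step^[n] c).1) : ∃ x, x ∉ (M.invalidFrom c).lang := by
  refine ⟨blockWord (((List.range (n + 1)).map fun i => M.step^[i] c).flatMap M.cells) 0,
    fun hx => ?_⟩
  rcases M.mem_lang_invalidFrom.1 hx with hx | hx
  · exact M.history_not_mem_invalid (M.isHistory_of_halting h) hx
  · refine hx ?_
    rw [List.range_succ_eq_map, List.map_cons, List.flatMap_cons, blockWord_append]
    exact List.prefix_append _ _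

/-- This is where short words are excluded: every register of the halting configuration is a unary
block of the word, so the word is at least as long as its contents. -/
theorem exists_halting_of_not_mem_invalidFrom {c : Q × (Fin 4 → ℕ)} {x : List Bool}
    (hx : x ∉ (M.invalidFrom c).lang) :
    ∃ n, M.halting (M.step^[n] c).1 ∧ ∀ i, (M.step^[n] c).2 i ≤ x.length := by
  rw [mem_lang_invalidFrom, not_or, not_not] at hx
  obtain ⟨hx, y, rfl⟩ := hx
  obtain ⟨ns, m, hns⟩ := exists_blockWord (blocks (M.cells c) ++ y)
  obtain ⟨post, rfl, -⟩ := blockWord_eq_blocks_append.1 hns.symm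
  rw [hns] at hx ⊢
  obtain ⟨n, hn, hmem⟩ := M.exists_halting_of_not_mem_invalid (ls := []) (pre := [])
    (by simp) rfl hx
  exact ⟨n, hn, fun i => le_length_blockWord (hmem i)⟩

/-- The machine enters only through a constant; the initial registers enter linearly, by the unary
prefix. The number `231` is `5` for the sum, `1` for the end of `notPrefix` and `45 * 5` for the
five closing zeros. -/
theorem cost_invalidFrom_le (c : Q × (Fin 4 → ℕ)) :
    (M.invalidFrom c).cost ≤
      M.invalid.cost + 45 * Fintype.card (Q × Fin 5) + 231 + 45 * ∑ i, c.2 i := by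
  have h1 := cost_notPrefix_le (blocks (M.cells c))
  have h2 : (blocks (M.cells c)).length = code (c.1, M.digit c) + ∑ i, c.2 i + 5 := by
    simp [blocks, cells, Fin.sum_univ_four]
    ring
  have h3 := code_lt (c.1, M.digit c)
  simp only [invalidFrom, cost]
  omega

end RegMachine

/-! ### Register machines from multi-stack machines -/

namespace RegMachine

variable {Q : Type} (M : RegMachine Q)

/-- The restriction of a machine to a set of states that is closed under its transitions. -/
def restrict (T : Finset Q) (hT : ∀ q ∈ T, ∀ d, M.next q d ∈ T) : RegMachine {q // q ∈ T} where
  reg q := M.reg q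
  next q d := ⟨M.next q d, hT q q.2 d⟩
  op q d := M.op q d
  halting q := M.halting q

theorem iterate_step_restrict (T : Finset Q) (hT : ∀ q ∈ T, ∀ d, M.next q d ∈ T) (n : ℕ)
    (c : {q // q ∈ T} × (Fin 4 → ℕ)) :
    M.step^[n] (c.1, c.2) =
      (((M.restrict T hT).step^[n] c).1.1, ((M.restrict T hT).step^[n] c).2) := by
  induction n generalizing c with
  | zero => rfl
  | succ n ih =>
    rw [Function.iterate_succ_apply, Function.iterate_succ_apply, ← ih]
    rfl

/-- Halting configurations are fixed points, so all times at which the machine halts show the same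
configuration, and its registers may be called the output. -/
theorem iterate_step_eq_of_halting (hM : ∀ c, M.halting c.1 → M.step c = c)
    {c : Q × (Fin 4 → ℕ)} {m n : ℕ} (hm : M.halting (M.step^[m] c).1)
    (hn : M.halting (M.step^[n] c).1) : M.step^[m] c = M.step^[n] c := by
  wlog h : m ≤ n generalizing m n
  · exact (this hn hm (le_of_not_ge h)).symm
  · obtain ⟨d, rfl⟩ := Nat.exists_eq_add_of_le' h
    rw [Function.iterate_add_apply, Function.iterate_fixed (hM _ hm)]

end RegMachine

namespace StackMachine

open Turing

variable {K Γ Λ σ : Type} (kn : K ≃ Fin 4) (dig : Γ → Fin 5) (undig : Fin 5 → Option Γ)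
  (tr : Λ → TM2.Stmt (fun _ : K => Γ) Λ σ)

/-- The base-five number whose digits, beginning with the last one, code the list. -/
def val : List Γ → ℕ
  | [] => 0
  | a :: l => 5 * val l + dig a

/-- The registers that hold the given stacks. -/
def regs (S : K → List Γ) (i : Fin 4) : ℕ :=
  val dig (S (kn.symm i))

theorem regs_update [DecidableEq K] (S : K → List Γ) (k : K) (l : List Γ) :
    regs kn dig (Function.update S k l) =
      Function.update (regs kn dig S) (kn k) (val dig l) := by
  funext i
  obtain ⟨j, rfl⟩ := kn.surjective i
  by_cases h : j = k
  · subst h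
    simp [regs]
  · simp [regs, h]

/-- The register machine that runs the statements of a multi-stack machine. -/
def toRegMachine : RegMachine (TM2.Stmt (fun _ : K => Γ) Λ σ × σ) where
  reg s :=
    match s.1 with
    | .push k _ _ => kn k
    | .peek k _ _ => kn k
    | .pop k _ _ => kn k
    | _ => 0
  next s d :=
    match s.1 with
    | .push _ _ q => (q, s.2)
    | .peek _ f q => (q, f s.2 (undig d))
    | .pop _ f q => (q, f s.2 (undig d))
    | .load a q => (q, a s.2)
    | .branch p q₁ q₂ => (if p s.2 then q₁ else q₂, s.2)
    | .goto l => (tr (l s.2), s.2)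
    | .halt => (.halt, s.2)
  op s _ :=
    match s.1 with
    | .push _ f _ => .push (dig (f s.2))
    | .pop _ _ _ => .pop
    | _ => .keep
  halting s := s.1 = .halt

/-- The configuration of the register machine that belongs to one of the multi-stack machine. -/
def config (c : TM2.Cfg (fun _ : K => Γ) Λ σ) :
    (TM2.Stmt (fun _ : K => Γ) Λ σ × σ) × (Fin 4 → ℕ) :=
  ((c.l.elim .halt tr, c.var), regs kn dig c.stk)

theorem step_eq_of_halting
    (c : (TM2.Stmt (fun _ : K => Γ) Λ σ × σ) × (Fin 4 → ℕ))
    (h : (toRegMachine kn dig undig tr).halting c.1) :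
    (toRegMachine kn dig undig tr).step c = c := by
  obtain ⟨⟨q, v⟩, r⟩ := c
  obtain rfl : q = .halt := h
  simp [toRegMachine, RegMachine.step, StackOp.app]

variable {dig undig}

/-- No symbol has digit `0`, so the last digit of a register tells an empty stack from a nonempty
one and determines the top symbol. -/
theorem undig_digit (hd : ∀ a, undig (dig a) = some a) (h0 : undig 0 = none)
    (l : List Γ) (h : val dig l % 5 < 5) :
    undig ⟨val dig l % 5, h⟩ = l.head? := by
  cases l with
  | nil => simpa [val] using h0
  | cons a l =>
    have h1 : (⟨val dig (a :: l) % 5, h⟩ : Fin 5) = dig a := by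
      ext
      simp only [val]
      omega
    rw [h1, hd, List.head?_cons]

/-- The states of the register machine are the remaining statements, so one big step of the stack
machine becomes one small step for each statement executed; `halt` needs none. -/
theorem exists_iterate_step_stepAux [DecidableEq K] (hd : ∀ a, undig (dig a) = some a) (h0 : undig 0 = none)
    (q : TM2.Stmt (fun _ : K => Γ) Λ σ) (v : σ) (S : K → List Γ) :
    ∃ n, (toRegMachine kn dig undig tr).step^[n] ((q, v), regs kn dig S) =
      config kn dig tr (TM2.stepAux q v S) := by
  have hu : ∀ (S : K → List Γ) (k : K) (h : regs kn dig S (kn k) % 5 < 5),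
      undig ⟨regs kn dig S (kn k) % 5, h⟩ = (S k).head? := by
    intro S k h
    rw [← undig_digit hd h0 (S k) (Nat.mod_lt _ (by norm_num))]
    simp [regs]
  induction q generalizing v S with
  | push k f q ih =>
    obtain ⟨n, hn⟩ := ih v (Function.update S k (f v :: S k))
    refine ⟨n + 1, ?_⟩
    rw [Function.iterate_succ_apply, TM2.stepAux, ← hn, regs_update]
    simp [toRegMachine, RegMachine.step, StackOp.app, val, regs]
  | peek k f q ih =>
    obtain ⟨n, hn⟩ := ih (f v (S k).head?) S
    refine ⟨n + 1, ?_⟩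
    rw [Function.iterate_succ_apply, TM2.stepAux, ← hn, ← hu S k (Nat.mod_lt _ (by norm_num))]
    simp [toRegMachine, RegMachine.step, StackOp.app, RegMachine.digit]
  | pop k f q ih =>
    obtain ⟨n, hn⟩ := ih (f v (S k).head?) (Function.update S k (S k).tail)
    refine ⟨n + 1, ?_⟩
    have h1 : val dig (S k).tail = regs kn dig S (kn k) / 5 := by
      rw [regs, Equiv.symm_apply_apply]
      cases S k with
      | nil => simp [val]
      | cons a l =>
        simp only [val, List.tail_cons]
        omega
    rw [Function.iterate_succ_apply, TM2.stepAux, ← hn, ← hu S k (Nat.mod_lt _ (by norm_num)),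
      regs_update, h1]
    simp [toRegMachine, RegMachine.step, StackOp.app, RegMachine.digit]
  | load a q ih =>
    obtain ⟨n, hn⟩ := ih (a v) S
    refine ⟨n + 1, ?_⟩
    rw [Function.iterate_succ_apply, TM2.stepAux, ← hn]
    simp [toRegMachine, RegMachine.step, StackOp.app]
  | branch p q₁ q₂ ih₁ ih₂ =>
    cases hp : p v with
    | true =>
      obtain ⟨n, hn⟩ := ih₁ v S
      refine ⟨n + 1, ?_⟩
      rw [Function.iterate_succ_apply, TM2.stepAux, hp, cond_true, ← hn]
      simp [toRegMachine, RegMachine.step, StackOp.app, hp]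
    | false =>
      obtain ⟨n, hn⟩ := ih₂ v S
      refine ⟨n + 1, ?_⟩
      rw [Function.iterate_succ_apply, TM2.stepAux, hp, cond_false, ← hn]
      simp [toRegMachine, RegMachine.step, StackOp.app, hp]
  | goto l =>
    refine ⟨1, ?_⟩
    simp [toRegMachine, RegMachine.step, StackOp.app, TM2.stepAux, config]
  | halt => exact ⟨0, rfl⟩

theorem exists_iterate_step_of_reaches [DecidableEq K] (hd : ∀ a, undig (dig a) = some a) (h0 : undig 0 = none)
    {a b : TM2.Cfg (fun _ : K => Γ) Λ σ}
    (h : StateTransition.Reaches (TM2.step tr) a b) :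
    ∃ n, (toRegMachine kn dig undig tr).step^[n] (config kn dig tr a) = config kn dig tr b := by
  induction h using Relation.ReflTransGen.head_induction_on with
  | refl => exact ⟨0, rfl⟩
  | @head a c hac _ ih =>
    obtain ⟨n, hn⟩ := ih
    obtain ⟨_ | l, v, S⟩ := a
    · simp at hac
    · obtain rfl : TM2.stepAux (tr l) v S = c := by simpa using hac
      obtain ⟨m, hm⟩ := exists_iterate_step_stepAux kn tr hd h0 (tr l) v S
      refine ⟨n + m, ?_⟩
      rw [Function.iterate_add_apply, ← hn, ← hm]
      rfl

open Classical in
/-- The states of the register machine that belong to a finite set of labels. -/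
noncomputable def states [Fintype σ] (S : Finset Λ) :
    Finset (TM2.Stmt (fun _ : K => Γ) Λ σ × σ) :=
  insert .halt (S.biUnion fun l => TM2.stmts₁ (tr l)) ×ˢ Finset.univ

theorem mem_states [Fintype σ] {S : Finset Λ} {l : Λ} (hl : l ∈ S) (v : σ) :
    (tr l, v) ∈ states tr S := by
  classical
  exact Finset.mem_product.2 ⟨Finset.mem_insert_of_mem
    (Finset.mem_biUnion.2 ⟨l, hl, TM2.stmts₁_self⟩), Finset.mem_univ _⟩

theorem next_mem_states [Fintype σ] {S : Finset Λ} (hS : ∀ l ∈ S, TM2.SupportsStmt S (tr l))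
    (s : TM2.Stmt (fun _ : K => Γ) Λ σ × σ) (hs : s ∈ states tr S) (d : Fin 5) :
    (toRegMachine kn dig undig tr).next s d ∈ states tr S := by
  obtain ⟨q, v⟩ := s
  simp only [states, Finset.mem_product, Finset.mem_univ, and_true, Finset.mem_insert,
    Finset.mem_biUnion] at hs ⊢
  rcases hs with rfl | ⟨l, hl, hq⟩
  · exact Or.inl rfl
  · have h1 := TM2.stmts₁_trans hq
    cases q with
    | push k f q =>
      exact Or.inr ⟨l, hl, h1 (by simp [toRegMachine, TM2.stmts₁, TM2.stmts₁_self])⟩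
    | peek k f q =>
      exact Or.inr ⟨l, hl, h1 (by simp [toRegMachine, TM2.stmts₁, TM2.stmts₁_self])⟩
    | pop k f q =>
      exact Or.inr ⟨l, hl, h1 (by simp [toRegMachine, TM2.stmts₁, TM2.stmts₁_self])⟩
    | load a q =>
      exact Or.inr ⟨l, hl, h1 (by simp [toRegMachine, TM2.stmts₁, TM2.stmts₁_self])⟩
    | branch p q₁ q₂ =>
      refine Or.inr ⟨l, hl, h1 ?_⟩
      cases hp : p v <;> simp [toRegMachine, TM2.stmts₁, TM2.stmts₁_self, hp]
    | goto f =>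
      exact Or.inr ⟨f v, TM2.stmts₁_supportsStmt_mono hq (hS l hl) v, TM2.stmts₁_self⟩
    | halt => exact Or.inl rfl

end StackMachine

/-! ### Computable functions on register machines -/

section Computable

open Turing Turing.PartrecToTM2 StackMachine

/-- The numbers of the stacks. -/
def stackEquiv : K' ≃ Fin 4 where
  toFun k := K'.casesOn k 0 1 2 3
  invFun := ![.main, .rev, .aux, .stack]
  left_inv k := by cases k <;> rfl
  right_inv i := by fin_cases i <;> rfl

/-- The digits that code the stack symbols. -/
def digit : Γ' → Fin 5
  | .consₗ => 1
  | .cons => 2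
  | .bit0 => 3
  | .bit1 => 4

/-- The stack symbol that is coded by a digit. -/
def undigit : Fin 5 → Option Γ' :=
  ![none, some .consₗ, some .cons, some .bit0, some .bit1]

theorem undigit_digit (a : Γ') : undigit (digit a) = some a := by
  cases a <;> rfl

/-- A further binary digit at least doubles the number, and sends the base-five value `v` to at most
`5 * v + 4`. Since `5 < 2 ^ 3`, the value stays below a multiple of the cube. The upper bound keeps
the initial configuration polynomial; the lower bound makes the output register at least as large as
the output. -/
theorem val_trPosNum (p : PosNum) :
    (p : ℕ) ≤ val digit (trPosNum p ++ [Γ'.cons]) ∧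
      val digit (trPosNum p ++ [Γ'.cons]) ≤ 25 * (p : ℕ) ^ 3 := by
  induction p with
  | one => simp [trPosNum, val, digit]
  | bit0 p ih =>
    have h1 : 1 ≤ (p : ℕ) ^ 3 := Nat.one_le_pow _ _ (PosNum.cast_pos p)
    have h2 : ((PosNum.bit0 p : PosNum) : ℕ) = 2 * p := by simp [two_mul]
    have h3 : (2 * (p : ℕ)) ^ 3 = 8 * (p : ℕ) ^ 3 := by ring
    rw [h2, h3]
    simp only [trPosNum, List.cons_append, val, digit, Fin.isValue]
    have : ((3 : Fin 5) : ℕ) = 3 := rfl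
    omega
  | bit1 p ih =>
    have h1 : 1 ≤ (p : ℕ) ^ 3 := Nat.one_le_pow _ _ (PosNum.cast_pos p)
    have h2 : ((PosNum.bit1 p : PosNum) : ℕ) = 2 * p + 1 := by simp [two_mul]
    have h3 : 8 * (p : ℕ) ^ 3 ≤ (2 * (p : ℕ) + 1) ^ 3 := by
      calc 8 * (p : ℕ) ^ 3 = (2 * (p : ℕ)) ^ 3 := by ring
        _ ≤ _ := Nat.pow_le_pow_left (by omega) 3
    rw [h2]
    simp only [trPosNum, List.cons_append, val, digit, Fin.isValue]
    have : ((4 : Fin 5) : ℕ) = 4 := rfl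
    omega

theorem val_trList_singleton (n : ℕ) :
    n ≤ val digit (trList [n]) ∧ val digit (trList [n]) ≤ 25 * (n + 1) ^ 3 := by
  have h1 : trList [n] = trNum (n : Num) ++ [Γ'.cons] := rfl
  have h2 : ((n : Num) : ℕ) = n := Num.to_of_nat n
  rw [h1]
  cases h : (n : Num) with
  | zero =>
    rw [h] at h2
    obtain rfl : n = 0 := by simpa using h2.symm
    simp [trNum, val, digit]
  | pos p =>
    rw [h] at h2
    have h3 : (p : ℕ) = n := by simpa using h2
    have h4 := val_trPosNum p
    rw [h3] at h4
    exact ⟨h4.1, h4.2.trans (Nat.mul_le_mul_left _ (Nat.pow_le_pow_left (Nat.le_succ n) 3))⟩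

theorem exists_code_of_computable {f : ℕ → ℕ} (hf : Computable f) :
    ∃ c : ToPartrec.Code, ∀ k, c.eval [k] = pure [f k] := by
  have h1 : Partrec (f : ℕ →. ℕ) := hf
  obtain ⟨c, hc⟩ := ToPartrec.Code.exists_code (Nat.Partrec'.part_iff₁.2 h1)
  refine ⟨c, fun k => ?_⟩
  have h2 := hc (k ::ᵥ List.Vector.nil)
  rw [show (k ::ᵥ List.Vector.nil).1 = [k] from rfl] at h2
  simpa using h2

/-- A register machine that computes `f`, in the sense that its register contents grow at least as
large as the value of `f`. -/
theorem exists_regMachine {f : ℕ → ℕ} (hf : Computable f) :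
    ∃ (Q : Type) (_ : Fintype Q) (M : RegMachine Q) (init : ℕ → Q × (Fin 4 → ℕ)), ∀ k,
      (∃ n, M.halting (M.step^[n] (init k)).1) ∧
      (∀ n, M.halting (M.step^[n] (init k)).1 → ∃ i, f k ≤ (M.step^[n] (init k)).2 i) ∧
      ∑ i, (init k).2 i ≤ 25 * (k + 1) ^ 3 := by
  obtain ⟨code, hcode⟩ := exists_code_of_computable hf
  let S := codeSupp code Cont'.halt
  have hS := tr_supports code Cont'.halt
  let M := toRegMachine stackEquiv digit undigit tr
  let T := states tr S
  have hT : ∀ q ∈ T, ∀ d, M.next q d ∈ T := next_mem_states stackEquiv tr hS.2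
  let s : TM2.Stmt (fun _ : K' => Γ') Λ' (Option Γ') × Option Γ' :=
    (tr (trNormal code Cont'.halt), none)
  have hs : s ∈ T := mem_states tr hS.1 none
  -- There are infinitely many statements, but those occurring in the finitely many supporting
  -- labels are closed under transitions and give a finite state set.
  refine ⟨{q // q ∈ T}, inferInstance, M.restrict T hT,
    fun k => (⟨s, hs⟩, regs stackEquiv digit (K'.elim (trList [k]) [] [] [])), fun k => ?_⟩
  have hreach : StateTransition.Reaches (TM2.step tr) (init code [k]) (halt [f k]) := by
    have h1 := tr_eval code [k]
    rw [hcode] at h1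
    exact (StateTransition.mem_eval.1 (by rw [h1, Part.map_eq_map]; exact Part.mem_map _ (Part.mem_some _))).1
  obtain ⟨n, hn⟩ := exists_iterate_step_of_reaches stackEquiv tr undigit_digit rfl hreach
  have hc : config stackEquiv digit tr (init code [k]) =
      (s, regs stackEquiv digit (K'.elim (trList [k]) [] [] [])) := rfl
  have hhalt : M.halting (M.step^[n] (s, regs stackEquiv digit
      (K'.elim (trList [k]) [] [] []))).1 := by
    rw [← hc, hn]
    rfl
  have hres := fun m => M.iterate_step_restrict T hT m
    (⟨s, hs⟩, regs stackEquiv digit (K'.elim (trList [k]) [] [] []))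
  refine ⟨⟨n, ?_⟩, fun m hm => ⟨0, ?_⟩, ?_⟩
  · have h1 := hres n
    rw [h1] at hhalt
    exact hhalt
  · have h1 := hres m
    have hm' : M.halting (M.step^[m] (s, regs stackEquiv digit
        (K'.elim (trList [k]) [] [] []))).1 := by
      rw [h1]
      exact hm
    have h2 := M.iterate_step_eq_of_halting (step_eq_of_halting _ _ _ _) hm' hhalt
    rw [← hc, hn, hc, h1] at h2
    have h3 := congrFun (congrArg Prod.snd h2) 0
    change _ = val digit (trList [f k]) at h3
    exact (val_trList_singleton (f k)).1.trans h3.ge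
  · rw [Fin.sum_univ_four]
    change val digit (trList [k]) + 0 + 0 + 0 ≤ _
    exact (val_trList_singleton k).2

end Computable

/-! ### Indistinguishable linear grammars -/

/-- The grammar generates everything but the halting histories from `init k`. Its size is at most `B
+ 1125 * (k + 1) ^ 3` with `B` independent of `k`, hence at most `c = (k + 1) ^ 4` once `k` is
large. The machine can compute `h c` from `k` because `c` is an explicit function of `k`, fixed
before the machine and its size are known. -/
theorem exists_isLinear_forall_mem_language {h : ℕ → ℕ} (hh : Computable h) :
    ∃ (c : ℕ) (G : CFG), G.IsLinear ∧ G.size ≤ c ∧ PairExp.anyWord.toCFG.size ≤ c ∧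
      (∀ x : List Bool, x.length ≤ h c → x ∈ G.toGrammar.language) ∧
      ∃ x, x ∉ G.toGrammar.language := by
  -- The added `1` makes a word that is not generated strictly longer than `h c`.
  have hf : Computable fun k => h ((k + 1) ^ 4) + 1 := by
    have h1 : Primrec fun k : ℕ => (k + 1) * (k + 1) * ((k + 1) * (k + 1)) := by
      have h2 : Primrec fun k : ℕ => (k + 1) * (k + 1) :=
        Primrec.nat_mul.comp Primrec.succ Primrec.succ
      exact Primrec.nat_mul.comp h2 h2
    refine (Primrec.succ.to_comp.comp (hh.comp h1.to_comp)).of_eq fun k => ?_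
    rw [show (k + 1) ^ 4 = (k + 1) * (k + 1) * ((k + 1) * (k + 1)) by ring]
  obtain ⟨Q, _, M, init, hM⟩ := exists_regMachine hf
  let B := M.invalid.cost + 45 * Fintype.card (Q × Fin 5) + 231 + 4
  -- Each summand serves one need: `B` and `1125 = 45 * 25` absorb the size bound into one more
  -- factor `k + 1`, and the last one makes the grammar of all words small enough.
  let k := B + 1125 + PairExp.anyWord.toCFG.size
  obtain ⟨⟨n, hn⟩, hlarge, hsum⟩ := hM k
  have h1 : 1 ≤ (k + 1) ^ 3 := Nat.one_le_pow _ _ (Nat.succ_pos k)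
  have h2 : (k + 1) ^ 4 = (k + 1) ^ 3 * (k + 1) := pow_succ _ _
  have h3 : B + 1125 * (k + 1) ^ 3 ≤ (k + 1) ^ 4 := by
    rw [h2]
    calc B + 1125 * (k + 1) ^ 3 ≤ (k + 1) ^ 3 * B + (k + 1) ^ 3 * 1125 := by
          rw [mul_comm 1125]
          exact Nat.add_le_add_right (Nat.le_mul_of_pos_left _ h1) _
      _ = (k + 1) ^ 3 * (B + 1125) := (mul_add _ _ _).symm
      _ ≤ _ := Nat.mul_le_mul_left _ (by omega)
  have h4 : PairExp.anyWord.toCFG.size ≤ (k + 1) ^ 4 := by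
    have : k + 1 ≤ (k + 1) ^ 4 := Nat.le_self_pow (by norm_num) _
    omega
  refine ⟨(k + 1) ^ 4, (M.invalidFrom (init k)).toCFG, PairExp.isLinear_toCFG _, ?_, h4,
    fun x hx => ?_, ?_⟩
  · have h5 := PairExp.size_toCFG_le (M.invalidFrom (init k))
    have h6 := M.cost_invalidFrom_le (init k)
    omega
  · rw [PairExp.mem_language_toCFG]
    by_contra hx'
    obtain ⟨n, hn, hle⟩ := M.exists_halting_of_not_mem_invalidFrom hx'
    obtain ⟨i, hi⟩ := hlarge n hn
    have := hle i
    omega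
  · obtain ⟨x, hx⟩ := M.exists_not_mem_invalidFrom hn
    exact ⟨x, by rwa [PairExp.mem_language_toCFG]⟩

/-! ### Consequences for learners -/

theorem trainingSet_congr {N : ℕ} {f g : List Bool → Bool}
    (h : ∀ x : List Bool, x.length ≤ N → f x = g x) : trainingSet N f = trainingSet N g :=
  List.map_congr_left fun x hx => by rw [h x (mem_stringsUpTo.1 hx)]

theorem funComplexity_le (R : List Bool → List Bool → Bool) (C : List Bool → ℕ)
    (p : List Bool) : funComplexity R C (R p) ≤ C p :=
  Nat.sInf_le ⟨p, rfl, rfl⟩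

theorem cfgEncoding_encode_of_isLinear {G : CFG} (hG : G.IsLinear) :
    cfgEncoding G.encode = linearCFGEncoding G.encode := by
  funext x
  rw [Bool.eq_iff_iff, cfgEncoding_encode, linearCFGEncoding_encode]
  exact ⟨fun h => ⟨hG, h⟩, And.right⟩

theorem range_linearCFGEncoding_subset :
    Set.range linearCFGEncoding ⊆ Set.range cfgEncoding := by
  rintro _ ⟨p, rfl⟩
  by_cases hp : ∃ G : CFG, G.IsLinear ∧ G.encode = p
  · obtain ⟨G, hG, rfl⟩ := hp
    exact ⟨G.encode, cfgEncoding_encode_of_isLinear hG⟩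
  -- The empty string is not a code, since a code contains at least the separator of its first row;
  -- it thus represents the empty language in both systems.
  · refine ⟨[], funext fun x => ?_⟩
    have h1 : linearCFGEncoding p x = false := by
      simp only [linearCFGEncoding, decide_eq_false_iff_not]
      exact fun ⟨G, hG, h, _⟩ => hp ⟨G, hG, h⟩
    rw [h1]
    simp only [cfgEncoding, decide_eq_false_iff_not]
    rintro ⟨G, h, -⟩
    rw [CFG.encode, CFG.rows, List.flatMap_cons] at h
    exact CFG.encodeRow_ne_nil h

variable {R : List Bool → List Bool → Bool} {C : List Bool → ℕ}

/-- Two different functions of complexity at most `c` need not differ up to length `h c`. -/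
theorem exists_indistinguishable (hC : IsCFGSizeMeasure C)
    (hR : ∀ G : CFG, G.IsLinear → R G.encode = linearCFGEncoding G.encode)
    {h : ℕ → ℕ} (hh : Computable h) :
    ∃ (c : ℕ) (f g : List Bool → Bool), f ≠ g ∧ f ∈ Set.range linearCFGEncoding ∧
      g ∈ Set.range linearCFGEncoding ∧ funComplexity R C f ≤ c ∧ funComplexity R C g ≤ c ∧
      trainingSet (h c) f = trainingSet (h c) g := by
  obtain ⟨c, G, hG, hsize, hsize', hshort, x, hx⟩ := exists_isLinear_forall_mem_language hh
  have hlin := PairExp.isLinear_toCFG PairExp.anyWord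
  have htrue : ∀ y, linearCFGEncoding PairExp.anyWord.toCFG.encode y = true := fun y =>
    (linearCFGEncoding_encode _ _).2
      ⟨hlin, (PairExp.mem_language_toCFG _ _).2 (PairExp.mem_lang_anyWord y)⟩
  have hle : ∀ G : CFG, G.IsLinear → G.size ≤ c →
      funComplexity R C (linearCFGEncoding G.encode) ≤ c := fun G hG hc => by
    rw [← hR G hG]
    exact (funComplexity_le R C G.encode).trans ((hC G).trans_le hc)
  refine ⟨c, linearCFGEncoding G.encode, linearCFGEncoding PairExp.anyWord.toCFG.encode,
    fun heq => hx ?_, ⟨_, rfl⟩, ⟨_, rfl⟩, hle G hG hsize, hle _ hlin hsize',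
    trainingSet_congr fun y hy => ?_⟩
  · have h1 := htrue x
    rw [← heq] at h1
    exact ((linearCFGEncoding_encode _ _).1 h1).2
  · rw [htrue, linearCFGEncoding_encode]
    exact ⟨hG, hshort y hy⟩

theorem eq_of_learnsAt {A : List (List Bool × Bool) → List Bool} {f g : List Bool → Bool} {N : ℕ}
    (h : trainingSet N f = trainingSet N g) (hf : LearnsAt R A f N) (hg : LearnsAt R A g N) :
    f = g := by
  rw [← hf, ← hg, h]

/-- A finite bound excludes the infimum of the empty set, so the infimum is attained at some `n ≤
N`, and learning persists from `n` on. -/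
theorem learnsAt_of_lengthComplexity_le {A : List (List Bool × Bool) → List Bool}
    {f : List Bool → Bool} {N : ℕ} (h : lengthComplexity R A f ≤ N) : LearnsAt R A f N := by
  have hne : ((fun n : ℕ => (n : ℕ∞)) '' {n | ∀ m ≥ n, LearnsAt R A f m}).Nonempty := by
    rw [Set.nonempty_iff_ne_empty]
    intro he
    rw [lengthComplexity, he, sInf_empty] at h
    exact ENat.natCast_ne_top N (top_le_iff.1 h)
  obtain ⟨n, hn, hn'⟩ := csInf_mem hne
  exact hn N (Nat.cast_le.1 (hn'.trans_le h))

theorem not_computablyBounded_lengthComplexityUpTo (hC : IsCFGSizeMeasure C)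
    (A : List (List Bool × Bool) → List Bool) :
    ¬ ComputablyBounded (lengthComplexityUpTo linearCFGEncoding C
      (Set.range linearCFGEncoding) A) := by
  rintro ⟨h, hh, hbound⟩
  obtain ⟨c, f, g, hne, hf, hg, hfc, hgc, heq⟩ :=
    exists_indistinguishable (R := linearCFGEncoding) hC (fun _ _ => rfl) hh
  have hlearn : ∀ f ∈ Set.range linearCFGEncoding, funComplexity linearCFGEncoding C f ≤ c →
      LearnsAt linearCFGEncoding A f (h c) := fun f hf hfc =>
    by
    refine learnsAt_of_lengthComplexity_le (le_trans (le_sSup ?_) (hbound c))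
    exact Set.mem_image_of_mem _ ⟨hf, hfc⟩
  exact hne (eq_of_learnsAt heq (hlearn f hf hfc) (hlearn g hg hgc))

/-- The two indistinguishable functions may have different complexities below `c`, at which a bound
that is not monotone could exceed its value at `c`. The partial sums dominate all earlier values and
remain computable. -/
theorem exists_computable_monotone_ge {g : ℕ → ℕ} (hg : Computable g) :
    ∃ h : ℕ → ℕ, Computable h ∧ ∀ i j, i ≤ j → g i ≤ h j := by
  refine ⟨fun n => ∑ i ∈ Finset.range (n + 1), g i, ?_, fun i j hij =>
    Finset.single_le_sum (f := g) (fun _ _ => Nat.zero_le _) (Finset.mem_range.2 (by omega))⟩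
  have h1 : Computable₂ fun (_ : ℕ) (p : ℕ × ℕ) => p.2 + g (p.1 + 1) :=
    (Primrec.nat_add.to_comp.comp (Computable.snd.comp Computable.snd)
      (hg.comp (Computable.succ.comp (Computable.fst.comp Computable.snd))))
  refine (Computable.nat_rec Computable.id (Computable.const (g 0)) h1).of_eq fun n => ?_
  induction n with
  | zero => simp
  | succ n ih =>
    rw [Finset.sum_range_succ, ← ih]
    rfl

theorem not_admitsNonAsymptotic (hC : IsCFGSizeMeasure C)
    (hR : ∀ G : CFG, G.IsLinear → R G.encode = linearCFGEncoding G.encode)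
    {F : Set (List Bool → Bool)} (hF : Set.range linearCFGEncoding ⊆ F) :
    ¬ AdmitsNonAsymptotic R C F := by
  rintro ⟨A, -, u, hu, hA⟩
  obtain ⟨h, hh, hle⟩ := exists_computable_monotone_ge hu
  obtain ⟨c, f, g, hne, hf, hg, hfc, hgc, heq⟩ := exists_indistinguishable hC hR hh
  exact hne (eq_of_learnsAt heq (hA f (hF hf) _ (hle _ _ hfc)) (hA g (hF hg) _ (hle _ _ hgc)))

end LengthGen

theorem proposition3p4 (C : List Bool → ℕ) (hC : LengthGen.IsCFGSizeMeasure C) :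
    -- the two representations are encoding systems
    (LengthGen.IsEncodingSystem LengthGen.linearCFGEncoding ∧
      LengthGen.IsEncodingSystem LengthGen.cfgEncoding) ∧
    -- no learner has a computably bounded length complexity on linear CFGs
    (∀ A : List (List Bool × Bool) → List Bool, Computable A →
      ¬ LengthGen.ComputablyBounded
        (LengthGen.lengthComplexityUpTo LengthGen.linearCFGEncoding C
          (Set.range LengthGen.linearCFGEncoding) A)) ∧
    -- no non-asymptotic length generalization
    (¬ LengthGen.AdmitsNonAsymptotic LengthGen.linearCFGEncoding C
        (Set.range LengthGen.linearCFGEncoding) ∧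
      ¬ LengthGen.AdmitsNonAsymptotic LengthGen.cfgEncoding C
        (Set.range LengthGen.linearCFGEncoding) ∧
      ¬ LengthGen.AdmitsNonAsymptotic LengthGen.cfgEncoding C
        (Set.range LengthGen.cfgEncoding)) ∧
    -- length generalization in the limit
    (LengthGen.AdmitsLimit LengthGen.linearCFGEncoding
        (Set.range LengthGen.linearCFGEncoding) ∧
      LengthGen.AdmitsLimit LengthGen.cfgEncoding (Set.range LengthGen.linearCFGEncoding) ∧
      LengthGen.AdmitsLimit LengthGen.cfgEncoding (Set.range LengthGen.cfgEncoding)) := by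
  have hsub := LengthGen.range_linearCFGEncoding_subset
  have hlin : ∀ G : LengthGen.CFG, G.IsLinear →
      LengthGen.cfgEncoding G.encode = LengthGen.linearCFGEncoding G.encode :=
    fun _ => LengthGen.cfgEncoding_encode_of_isLinear
  exact ⟨⟨LengthGen.isEncodingSystem_of_primrec LengthGen.primrec₂_linearCFGEncoding,
      LengthGen.isEncodingSystem_of_primrec LengthGen.primrec₂_cfgEncoding⟩,
    fun A _ => LengthGen.not_computablyBounded_lengthComplexityUpTo hC A,
    ⟨LengthGen.not_admitsNonAsymptotic hC (fun _ _ => rfl) subset_rfl,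
      LengthGen.not_admitsNonAsymptotic hC hlin subset_rfl,
      LengthGen.not_admitsNonAsymptotic hC hlin hsub⟩,
    LengthGen.admitsLimit_of_primrec LengthGen.primrec₂_linearCFGEncoding subset_rfl,
    LengthGen.admitsLimit_of_primrec LengthGen.primrec₂_cfgEncoding hsub,
    LengthGen.admitsLimit_of_primrec LengthGen.primrec₂_cfgEncoding subset_rfl⟩
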